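/- **Types.** Quantum systems are finite-dimensional. Every system is an elementary type, $AB$ denotes the elementary type of the composite of the systems $A$ and $B$, and $I$ is the trivial (one-dimensional) one; if $x,y$ are types, so is $(x\to y)$. Let $\mathsf{Ele}_x$ be the set of non-trivial systems (dimension at least $2$) occurring in the expression of $x$; systems are labelled so that no non-trivial system occurs twice in a type. Put $\mathcal H_x=\bigotimes_{A\in\mathsf{Ele}_x}\mathcal H_A$. For $A\in\mathsf{Ele}_x$ let $K_x(A)\in\{0,1\}$ be the parity of the number of symbols "$\to$" and "$($" to the right of $A$ in the (fully bracketed) expression of $x$; put $\mathsf{in}_x=\{A\in\mathsf{Ele}_x: K_x(A)=1\}$ and $\mathsf{out}_x=\mathsf{Ele}_x\setminus\mathsf{in}_x$. **Maps.** A map of type $x$ is an operator on $\mathcal H_x$; an operator $M$ on $\mathcal H_{x\to y}$ is the Choi operator, in a fixed product basis, of a linear map $\mathcal M:\mathcal L(\mathcal H_x)\to\mathcal L(\mathcal H_y)$. For an elementary type (system) $E$ put $A\|E=AE$ for $A$ elementary and $(x\to y)\|E=(x\to y\|E)$. The sets $\mathsf T_1(x)\subseteq\mathsf T(x)$ of deterministic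 and of admissible maps are defined recursively. * For $A$ elementary, $\mathsf T_1(A)=\{M\ge0:\operatorname{Tr}M=1\}$ and $\mathsf T(A)=\{M\ge 0: M\le N\text{ for some }N\in\mathsf T_1(A)\}$. * Say that $M$ of type $x\to y$ is completely admissible-preserving if for all elementary types $E$ the map $\mathcal M\otimes\mathcal I_E$ sends $\mathsf T(x\|E)$ into $\mathsf T(y\|E)$, and completely determinism-preserving if for all $E$ it sends $\mathsf T_1(x\|E)$ into $\mathsf T_1(y\|E)$. Then $M\in\mathsf T(x\to y)$ iff $M$ is completely admissible-preserving and there are finitely many (possibly no) completely admissible-preserving $N_1,\dots,N_n$ of type $x\to y$ such that $M+\sum_iN_i$ is completely determinism-preserving. And $M\in\mathsf T_1(x\to y)$ iff $M\in\mathsf T(x\to y)$ and $M$ is completely determinism-preserving. **Contraction.** Let $\dim\mathcal H_A=\dim\mathcal H_B$ and $\Phi_{AB}=\sum_{i,j}|ii\rangle\langle jj|$ on $\mathcal H_A\otimes\mathcal H_B$. For $R\in\mathcal L(\mathcal H_x)$ let $\mathcal C_{AB}(R)=\operatorname{Tr}_{AB}\big[R\,(I_{\mathsf{Ele}_x\setminus\{A,B\}}\otimes\Phi_{AB}^{\,\theta})\big]$,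 with $\theta$ the transpose; this is an operator on the systems $\mathsf{Ele}_x\setminus\{A,B\}$. The contraction $\mathcal C_{AB}(x)$ is *admissible* if for every $R\in\mathsf T_1(x)$ there is a type $z$ (with $\mathsf{Ele}_z=\mathsf{Ele}_x\setminus\{A,B\}$) such that $\mathcal C_{AB}(R)\in\mathsf T_1(z)$. **No-signalling.** For $A\in\mathsf{in}_x$, $B\in\mathsf{out}_x$, a map $R\in\mathsf T_1(x)$ is *no-signalling* from $A$ to $B$ if $\operatorname{Tr}_{\mathsf{out}_x\setminus\{B\}}[R]=I_A\otimes R'$ for some operator $R'$ on the systems $(\mathsf{in}_x\setminus\{A\})\cup\{B\}$. **Proposition.** Let $x$ be a type, $A\in\mathsf{in}_x$ and $B\in\mathsf{out}_x$ with $\dim\mathcal H_A=\dim\mathcal H_B$. Then the contraction $\mathcal C_{AB}(x)$ is admissible if and only if every deterministic map of type $x$ is no-signalling from $A$ to $B$. -/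

import Mathlib

open scoped ComplexOrder

universe u

namespace HOQ

/-! ### Types -/

/-- Types of higher-order maps. The labels `i : ι` name non-trivial quantum systems. An elementary
type is the composite of a finite set of labelled systems (a singleton is a single system, and the
empty set is the trivial one-dimensional system `I`); `arr x y` is the type `(x → y)`. -/
inductive QType (ι : Type u) : Type u
  | ele (S : Finset ι) : QType ι
  | arr (x y : QType ι) : QType ι

/-- Symbols of the alphabet in which types are written. -/
inductive Token (ι : Type u) : Type u
  | sys (S : Finset ι) : Token ι
  | arrow : Token ι
  | lpar : Token ι
  | rpar : Token ι

/-- The symbol is an elementary type in which the system `A` occurs. -/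
def Token.mentions {ι : Type u} [DecidableEq ι] (A : ι) : Token ι → Bool
  | .sys S => decide (A ∈ S)
  | _ => false

/-- The symbol is an arrow or an open round bracket. -/
def Token.isArrowOrOpen {ι : Type u} : Token ι → Bool
  | .arrow => true
  | .lpar => true
  | _ => false

namespace QType

variable {ι : Type u} [DecidableEq ι]

/-- The expression of a type as a word. -/
def word : QType ι → List (Token ι)
  | ele S => [Token.sys S]
  | arr x y => [Token.lpar] ++ word x ++ [Token.arrow] ++ word y ++ [Token.rpar]

/-- `Ele_x`: the non-trivial systems occurring in the expression of `x`. -/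
def systems : QType ι → Finset ι
  | ele S => S
  | arr x y => systems x ∪ systems y

/-- No label of a non-trivial system occurs twice in the expression of the type. -/
def WellLabelled : QType ι → Prop
  | ele _ => True
  | arr x y => WellLabelled x ∧ WellLabelled y ∧ Disjoint (systems x) (systems y)

/-- `K_x(A)`: the number of arrows and open brackets to the right of `A` in the expression of `x`,
modulo `2`. -/
def K (x : QType ι) (A : ι) : ℕ :=
  ((x.word.dropWhile (fun t => !(t.mentions A))).countP Token.isArrowOrOpen) % 2

/-- `in_x` -/
def ins (x : QType ι) : Finset ι := x.systems.filter (fun A => x.K A = 1)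

/-- `out_x` -/
def outs (x : QType ι) : Finset ι := x.systems \ x.ins

lemma systems_subset (x : QType ι) (A B : ι) :
    x.systems ⊆ ({A} ∪ (x.ins.erase A ∪ {B})) ∪ x.outs.erase B := by
  intro i hi
  simp only [outs, Finset.mem_union, Finset.mem_singleton, Finset.mem_erase, Finset.mem_sdiff]
  tauto

end QType

/-! ### Operators on labelled tensor products -/

section Operators

variable {ι : Type u} [DecidableEq ι] (d : ι → ℕ)

/-- Product basis of the tensor product of the systems in `S`, where system `i` is `ℂ ^ (d i)`. -/
abbrev Idx (S : Finset ι) : Type u := (i : {i // i ∈ S}) → Fin (d i)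

/-- `L(H_S)`, where `H_S` is the tensor product of the systems in `S`. -/
abbrev Op (S : Finset ι) : Type u := Matrix (Idx d S) (Idx d S) ℂ

/-- `L(H_S ⊗ H_E)`, where `E` is the basis of an additional (ancillary) system. -/
abbrev XOp (S : Finset ι) (E : Type u) : Type u := Matrix (Idx d S × E) (Idx d S × E) ℂ

variable {d}

/-- The basis label on `S ⊆ U ∪ V` obtained from basis labels on `U` and on `V`. -/
def merge {S U V : Finset ι} (h : S ⊆ U ∪ V) (a : Idx d U) (b : Idx d V) : Idx d S :=
  fun i => if hU : i.1 ∈ U then a ⟨i.1, hU⟩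
    else b ⟨i.1, (Finset.mem_union.mp (h i.2)).resolve_left hU⟩

/-- The restriction of a basis label to a subset of the systems. -/
def restrict {S U : Finset ι} (h : S ⊆ U) (a : Idx d U) : Idx d S :=
  fun i => a ⟨i.1, h i.2⟩

/-- Tensor product of operators on (disjoint) sets of systems. -/
def tensor {S T : Finset ι} (P : Op d S) (Q : Op d T) : Op d (S ∪ T) :=
  fun c c' =>
    P (restrict Finset.subset_union_left c) (restrict Finset.subset_union_left c') *
      Q (restrict Finset.subset_union_right c) (restrict Finset.subset_union_right c')

/-- Partial trace over the systems in `V` of an operator on the systems `S = U ∪ V`. -/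
noncomputable def ptrace {S U V : Finset ι} (h : S ⊆ U ∪ V) (R : Op d S) : Op d U :=
  fun c c' => ∑ v : Idx d V, R (merge h c v) (merge h c' v)

/-- The link product `R * T = Tr_{S ∩ T} [(R ⊗ I) (I ⊗ T ^ θ)]`, where `θ` is the partial transpose
on the shared systems `S ∩ T`, written out in the product basis. -/
noncomputable def link {S T : Finset ι} (P : Op d S) (Q : Op d T) :
    Op d ((S ∪ T) \ (S ∩ T)) :=
  have hS : S ⊆ ((S ∪ T) \ (S ∩ T)) ∪ (S ∩ T) :=
    fun i hi => by
      simp only [Finset.mem_union, Finset.mem_sdiff, Finset.mem_inter]; tauto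
  have hT : T ⊆ ((S ∪ T) \ (S ∩ T)) ∪ (S ∩ T) :=
    fun i hi => by
      simp only [Finset.mem_union, Finset.mem_sdiff, Finset.mem_inter]; tauto
  fun c c' => ∑ k : Idx d (S ∩ T), ∑ k' : Idx d (S ∩ T),
    P (merge hS c k) (merge hS c' k') * Q (merge hT c k) (merge hT c' k')

/-- `Φ_{AB} = ∑_{i,j} |ii⟩⟨jj|`. -/
def Phi (A B : ι) : Op d {A, B} :=
  fun c c' =>
    if (c ⟨A, by simp⟩ : ℕ) = (c ⟨B, by simp⟩ : ℕ) ∧ (c' ⟨A, by simp⟩ : ℕ) = (c' ⟨B, by simp⟩ : ℕ)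
    then 1 else 0

/-- `C_{AB}(R) = R * Φ_{AB}`. -/
noncomputable def contract {S : Finset ι} (A B : ι) (R : Op d S) :
    Op d ((S ∪ {A, B}) \ (S ∩ {A, B})) :=
  link R (Phi A B)

/-- If `M` is the Choi operator of a linear map `𝓜 : L(H_S) → L(H_T ⊗ H_E)`, then
`act M R = (𝓜 ⊗ 𝓘_F) (R)` for `R` in `L(H_S ⊗ H_F)`; that is, `Tr_S [(R ^ θ ⊗ I) M]` with `θ` the
partial transpose on the systems in `S`. -/
noncomputable def act {S T : Finset ι} {E F : Type u} (M : XOp d (S ∪ T) E) (R : XOp d S F) :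
    XOp d T (E × F) :=
  fun p q => ∑ a : Idx d S, ∑ a' : Idx d S,
    R (a, p.2.2) (a', q.2.2) *
      M (merge (Finset.Subset.refl (S ∪ T)) a p.1, p.2.1)
        (merge (Finset.Subset.refl (S ∪ T)) a' q.1, q.2.1)

end Operators

/-! ### Admissible and deterministic maps -/

/-- A set of admissible maps together with a set of deterministic maps. -/
structure MapSets (n : Type u) : Type u where
  adm : Set (Matrix n n ℂ)
  det : Set (Matrix n n ℂ)

variable {ι : Type u} [DecidableEq ι] (d : ι → ℕ)

/-- The admissible and the deterministic maps of the extended type `x ‖ E`, where `E` is an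
elementary system, by recursion on `x`: if `x = ele S`, then `x ‖ E` is the elementary type of the
composite system `S E`; and `(x → y) ‖ E = (x → y ‖ E)`, where `(y ‖ E) ‖ F = y ‖ E F`. -/
noncomputable def maps : (x : QType ι) → (E : Type u) → [Fintype E] →
    MapSets (Idx d x.systems × E)
  | .ele S, E, _ =>
    let states : Set (XOp d S E) := {M | M.PosSemidef ∧ M.trace = 1}
    { adm := {M : XOp d S E | M.PosSemidef ∧ ∃ N ∈ states, (N - M).PosSemidef}
      det := states }
  | .arr x y, E, _ =>
    let preservesAdm (M : XOp d (x.systems ∪ y.systems) E) : Prop :=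
      ∀ (F : Type u) [Fintype F] [Nonempty F],
        ∀ R ∈ (maps x F).adm, act M R ∈ (maps y (E × F)).adm
    let preservesDet (M : XOp d (x.systems ∪ y.systems) E) : Prop :=
      ∀ (F : Type u) [Fintype F] [Nonempty F],
        ∀ R ∈ (maps x F).det, act M R ∈ (maps y (E × F)).det
    let adm : Set (XOp d (x.systems ∪ y.systems) E) :=
      {M | preservesAdm M ∧
        ∃ (n : ℕ) (N : Fin n → XOp d (x.systems ∪ y.systems) E),
          (∀ i, preservesAdm (N i)) ∧ preservesDet (M + ∑ i, N i)}
    { adm := adm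
      det := {M | M ∈ adm ∧ preservesDet M} }

variable {d}

/-- `R`, an operator on the systems in `S`, is a deterministic map of type `x`; in particular `S` is
the set of systems of `x`. The trivial extension `x ‖ I` is identified with `x`. -/
def IsDeterministic (x : QType ι) {S : Finset ι} (R : Op d S) : Prop :=
  ∃ h : S ⊆ x.systems ∧ x.systems ⊆ S,
    R.submatrix (fun p : Idx d x.systems × PUnit.{u + 1} => restrict h.1 p.1)
      (fun p : Idx d x.systems × PUnit.{u + 1} => restrict h.1 p.1) ∈ (maps d x PUnit.{u + 1}).det

variable (d)

/-- The contraction `C_{AB}(x)` is admissible. -/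
def ContractionAdmissible (x : QType ι) (A B : ι) : Prop :=
  ∀ R : Op d x.systems, IsDeterministic x R →
    ∃ z : QType ι, z.WellLabelled ∧ IsDeterministic z (contract A B R)

variable {d}

/-- The map `R` of type `x` is no-signalling from the input `A` to the output `B`: the partial trace
of `R` over `out_x \ {B}` is `I_A ⊗ R'` for an operator `R'` on `in_x \ {A}` and `B`. -/
def MapNoSignalling (x : QType ι) (A B : ι) (R : Op d x.systems) : Prop :=
  ∃ R' : Op d (x.ins.erase A ∪ {B}),
    ptrace (x.systems_subset A B) R = tensor (1 : Op d {A}) R'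

variable (d)

/-- The type `x` is no-signalling from the input `A` to the output `B`. -/
def TypeNoSignalling (x : QType ι) (A B : ι) : Prop :=
  ∀ R : Op d x.systems, IsDeterministic x R → MapNoSignalling x A B R

end HOQ

/-!
The recursive definition of deterministic maps is first replaced by a linear one. By induction on
the type, the deterministic maps of type `x ‖ E` are exactly the positive operators whose partial
trace over `E` lies in an affine space `affineDet d x`; the admissible maps are the positive
operators below them (`maps_characterization`). Positivity of the Choi operator of a map that
preserves admissibility comes from its value at a maximally entangled state, and a map that sends
the positive part of `affineDet d x` to `affineDet d y` sends all of it there because a multiple of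
the identity is an interior point.

Three facts about `affineDet d x` suffice, each proved by induction on `x`: it is preserved by local
superoperators that preserve the identity and the trace (`loc_mem_affineDet`); depolarizing all
outputs of a member leaves a fixed multiple of the identity; and every suitably normalized operator
that is the identity on all inputs is a member (`affineDet_ins_outs`). The last two need each other,
since an arrow exchanges the inputs and outputs of its domain.

No-signalling of `R` from `A` to `B` means that `Q`, obtained from `R` by depolarizing all outputs
but `B`, does not change when `A` is depolarized (`mapNoSignalling_iff`). Under a contraction,
depolarizing `A` is the same as depolarizing `B` (`contractLinear_depol_left`). So if `R` is
no-signalling, then depolarizing the remaining outputs of its contraction gives the same as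
contracting an `R` with all outputs depolarized, a multiple of the identity: the contraction is a
channel from the remaining inputs to the remaining outputs, and channels are deterministic maps of
type `(I → O)`.

Conversely, let `R` be signalling. Then `Q` minus its depolarization on `A` is not zero, and a local
superoperator on `A` turns it into a direction of `affineDet d x` whose contraction `Y` is not zero
(`exists_contractLinear_sub_ne_zero`). A small multiple of this direction, made Hermitian, is added
to a deterministic map that prepares full-rank states, not maximally mixed, on the outputs other
than `B`. Suppose that the contraction of the sum is deterministic of some type `z`. The bias of the
prepared states forces all remaining outputs of `x` to be outputs of `z`; the trace, which is the
dimension of the inputs of `z` and changes little under a small perturbation, leaves no room for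
further outputs; and then `Y` has to vanish (`eq_zero_of_depol_bias_add`).
-/

set_option linter.unusedSectionVars false

namespace HOQ

open Matrix

/-! ### Splitting basis labels and sums over them -/

section Splitting

variable {ι : Type u} [DecidableEq ι] {d : ι → ℕ} {S U V : Finset ι}

lemma merge_left (h : S ⊆ U ∪ V) (hU : U ⊆ S) (a : Idx d U) (b : Idx d V) (i : ι) (hi : i ∈ U) :
    merge h a b ⟨i, hU hi⟩ = a ⟨i, hi⟩ := by
  simp [merge, hi]

lemma merge_right (h : S ⊆ U ∪ V) (hV : V ⊆ S) (hd : Disjoint U V) (a : Idx d U) (b : Idx d V)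
    (i : ι) (hi : i ∈ V) : merge h a b ⟨i, hV hi⟩ = b ⟨i, hi⟩ := by
  have : i ∉ U := fun hU => Finset.disjoint_left.mp hd hU hi
  simp [merge, this]

/-- Basis labels of a composite system are pairs of basis labels of the parts. -/
def splitEquiv (h : S ⊆ U ∪ V) (hU : U ⊆ S) (hV : V ⊆ S) (hd : Disjoint U V) :
    Idx d U × Idx d V ≃ Idx d S where
  toFun p := merge h p.1 p.2
  invFun c := (restrict hU c, restrict hV c)
  left_inv p := by
    refine Prod.ext (funext fun i => ?_) (funext fun i => ?_)
    · exact merge_left h hU p.1 p.2 i.1 i.2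
    · exact merge_right h hV hd p.1 p.2 i.1 i.2
  right_inv c := by
    funext i
    simp only [merge, restrict]
    split_ifs <;> rfl

lemma merge_restrict (h : S ⊆ U ∪ V) (hU : U ⊆ S) (hV : V ⊆ S) (hd : Disjoint U V)
    (c : Idx d S) : merge h (restrict hU c) (restrict hV c) = c :=
  (splitEquiv h hU hV hd).right_inv c

lemma restrict_merge_left (h : S ⊆ U ∪ V) (hU : U ⊆ S)
    (a : Idx d U) (b : Idx d V) : restrict hU (merge h a b) = a :=
  funext fun i => merge_left h hU a b i.1 i.2

lemma restrict_merge_right (h : S ⊆ U ∪ V) (hV : V ⊆ S) (hd : Disjoint U V)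
    (a : Idx d U) (b : Idx d V) : restrict hV (merge h a b) = b :=
  funext fun i => merge_right h hV hd a b i.1 i.2

lemma merge_inj (h : S ⊆ U ∪ V) (hU : U ⊆ S) (hV : V ⊆ S) (hd : Disjoint U V)
    {a a' : Idx d U} {b b' : Idx d V} : merge h a b = merge h a' b' ↔ a = a' ∧ b = b' := by
  constructor
  · intro e
    have := (splitEquiv h hU hV hd).injective (a₁ := (a, b)) (a₂ := (a', b')) e
    simpa using this
  · rintro ⟨rfl, rfl⟩; rfl

lemma sum_split (h : S ⊆ U ∪ V) (hU : U ⊆ S) (hV : V ⊆ S) (hd : Disjoint U V)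
    (f : Idx d S → ℂ) : ∑ c, f c = ∑ a : Idx d U, ∑ b : Idx d V, f (merge h a b) := by
  rw [← Fintype.sum_prod_type', ← (splitEquiv h hU hV hd).sum_comp]
  rfl

lemma prod_split {M : Type*} [CommMonoid M] (h : S ⊆ U ∪ V) (hU : U ⊆ S) (hV : V ⊆ S)
    (hd : Disjoint U V) (g : {i // i ∈ S} → M) :
    ∏ i, g i = (∏ i : {i // i ∈ U}, g ⟨i.1, hU i.2⟩) * ∏ i : {i // i ∈ V}, g ⟨i.1, hV i.2⟩ := by
  obtain rfl : S = U ∪ V := h.antisymm (Finset.union_subset hU hV)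
  rw [← (Equiv.Finset.union U V hd).prod_comp, Fintype.prod_sum_type]
  rfl

/-- The dimension of the composite of the systems in `S`. -/
def dim (d : ι → ℕ) (S : Finset ι) : ℂ := ∏ i : {i // i ∈ S}, (d i.1 : ℂ)

lemma dim_split (h : S ⊆ U ∪ V) (hU : U ⊆ S) (hV : V ⊆ S) (hd : Disjoint U V) :
    dim d S = dim d U * dim d V := prod_split h hU hV hd _

lemma dim_ne_zero (h : ∀ i ∈ S, 1 ≤ d i) : dim d S ≠ 0 := by
  refine Finset.prod_ne_zero_iff.mpr fun i _ => ?_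
  have := h i.1 i.2
  exact_mod_cast (by omega : d i.1 ≠ 0)

lemma dim_eq_natCast (d : ι → ℕ) (S : Finset ι) :
    dim d S = ((∏ i : {i // i ∈ S}, d i.1 : ℕ) : ℂ) := by
  simp [dim]

lemma card_Idx (d : ι → ℕ) (S : Finset ι) : (Fintype.card (Idx d S) : ℂ) = dim d S := by
  simp [dim]

lemma trace_one_Idx (d : ι → ℕ) (S : Finset ι) : (1 : Op d S).trace = dim d S := by
  rw [Matrix.trace_one, card_Idx]

lemma nonempty_Idx (h : ∀ i ∈ S, 1 ≤ d i) : Nonempty (Idx d S) :=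
  ⟨fun i => ⟨0, h i.1 i.2⟩⟩

lemma sum_sum_prod (f : (i : {i // i ∈ S}) → Fin (d i) → Fin (d i) → ℂ) :
    ∑ a : Idx d S, ∑ a' : Idx d S, ∏ i, f i (a i) (a' i) = ∏ i, ∑ j, ∑ k, f i j k := by
  rw [Finset.prod_univ_sum, Fintype.piFinset_univ]
  refine Finset.sum_congr rfl fun a _ => ?_
  rw [Finset.prod_univ_sum, Fintype.piFinset_univ]

lemma sum_prod (f : (i : {i // i ∈ S}) → Fin (d i) → ℂ) :
    ∑ a : Idx d S, ∏ i, f i (a i) = ∏ i, ∑ j, f i j := by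
  rw [Finset.prod_univ_sum, Fintype.piFinset_univ]

lemma prod_ite_eq_ite (a b : Idx d S) :
    ∏ i, (if a i = b i then (1 : ℂ) else 0) = if a = b then 1 else 0 := by
  rw [Finset.prod_ite_zero]
  simp [funext_iff]

end Splitting

/-! ### Tensor products of local superoperators -/

section Local

variable {ι : Type u} [DecidableEq ι] {d : ι → ℕ} {S T U V : Finset ι}

/-- A linear map on `n × n` matrices, as a matrix indexed by pairs of matrix indices: the entry at
`(c, c'), (a, a')` is the coefficient with which the entry `(a, a')` of the argument contributes
to the entry `(c, c')` of the value. -/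
abbrev Kernel (n : ℕ) : Type := Matrix (Fin n × Fin n) (Fin n × Fin n) ℂ

/-- The identity matrix as an argument of kernels. -/
def unitVec (n : ℕ) : Fin n × Fin n → ℂ := fun p => if p.1 = p.2 then 1 else 0

/-- The linear map of the kernel maps the identity to itself. -/
def IsUnital {n : ℕ} (k : Kernel n) : Prop := k *ᵥ unitVec n = unitVec n

/-- The linear map of the kernel preserves the trace. -/
def IsTP {n : ℕ} (k : Kernel n) : Prop := unitVec n ᵥ* k = unitVec n

/-- The tensor product of the superoperators with kernels `K i`, for `i ∈ S`. -/
noncomputable def loc (K : (i : ι) → Kernel (d i)) : Op d S →ₗ[ℂ] Op d S where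
  toFun M := Matrix.of fun c c' => ∑ a, ∑ a', (∏ i, K i.1 (c i, c' i) (a i, a' i)) * M a a'
  map_add' M N := by
    ext c c'
    simp only [Matrix.of_apply, Matrix.add_apply, mul_add, Finset.sum_add_distrib]
  map_smul' t M := by
    ext c c'
    simp only [Matrix.of_apply, Matrix.smul_apply, smul_eq_mul, Finset.mul_sum, mul_left_comm,
      RingHom.id_apply]

lemma loc_apply (K : (i : ι) → Kernel (d i)) (M : Op d S) (c c' : Idx d S) :
    loc K M c c' = ∑ a, ∑ a', (∏ i, K i.1 (c i, c' i) (a i, a' i)) * M a a' := rfl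

lemma loc_congr {K L : (i : ι) → Kernel (d i)} (h : ∀ i ∈ S, K i = L i) (M : Op d S) :
    loc K M = loc L M := by
  ext c c'
  simp only [loc_apply]
  refine Finset.sum_congr rfl fun a _ => Finset.sum_congr rfl fun a' _ => ?_
  congr 1
  exact Finset.prod_congr rfl fun i _ => by rw [h i.1 i.2]

lemma kernel_mul_apply {n : ℕ} (k l : Kernel n) (p q : Fin n × Fin n) :
    (k * l) p q = ∑ j, ∑ j', k p (j, j') * l (j, j') q := by
  rw [Matrix.mul_apply, Fintype.sum_prod_type]

lemma loc_loc (K L : (i : ι) → Kernel (d i)) (M : Op d S) :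
    loc K (loc L M) = loc (fun i => K i * L i) M := by
  ext c c'
  have key : ∀ b b' : Idx d S, ∑ a : Idx d S, ∑ a' : Idx d S,
      (∏ i, K i.1 (c i, c' i) (a i, a' i)) * ∏ i, L i.1 (a i, a' i) (b i, b' i) =
        ∏ i : {i // i ∈ S}, (K i.1 * L i.1) (c i, c' i) (b i, b' i) := fun b b' => by
    simp only [← Finset.prod_mul_distrib]
    rw [sum_sum_prod (fun i j j' => K i.1 (c i, c' i) (j, j') * L i.1 (j, j') (b i, b' i))]
    exact Finset.prod_congr rfl fun i _ => (kernel_mul_apply _ _ _ _).symm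
  simp only [loc_apply, ← key, Finset.mul_sum]
  simp only [← Fintype.sum_prod_type' (f := fun (a a' : Idx d S) => _)]
  rw [Finset.sum_comm]
  simp only [Finset.sum_mul, mul_assoc]

lemma prod_one_kernel (c c' a a' : Idx d S) :
    ∏ i : {i // i ∈ S}, (1 : Kernel (d i.1)) (c i, c' i) (a i, a' i) =
      if c = a ∧ c' = a' then 1 else 0 := by
  have : ∀ i : {i // i ∈ S}, (1 : Kernel (d i.1)) (c i, c' i) (a i, a' i) =
      (if c i = a i then (1 : ℂ) else 0) * (if c' i = a' i then (1 : ℂ) else 0) := fun i => by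
    rw [Matrix.one_apply]
    simp only [Prod.mk.injEq, ite_and, ite_mul, one_mul, zero_mul]
  simp only [this, Finset.prod_mul_distrib, prod_ite_eq_ite]
  simp only [ite_and, ite_mul, one_mul, zero_mul]

lemma loc_one (M : Op d S) : loc (fun _ => 1) M = M := by
  ext c c'
  rw [loc_apply]
  simp only [prod_one_kernel]
  rw [Finset.sum_eq_single c, Finset.sum_eq_single c'] <;> simp +contextual [eq_comm]

lemma loc_eq_self {K : (i : ι) → Kernel (d i)} (h : ∀ i ∈ S, K i = 1) (M : Op d S) :
    loc K M = M := by
  rw [loc_congr h, loc_one]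

lemma mulVec_unitVec {n : ℕ} (k : Kernel n) (p : Fin n × Fin n) :
    (k *ᵥ unitVec n) p = ∑ j, k p (j, j) := by
  simp [Matrix.mulVec, dotProduct, unitVec, Fintype.sum_prod_type]

lemma unitVec_vecMul {n : ℕ} (k : Kernel n) (p : Fin n × Fin n) :
    (unitVec n ᵥ* k) p = ∑ j, k (j, j) p := by
  simp [Matrix.vecMul, dotProduct, unitVec, Fintype.sum_prod_type]

lemma IsUnital.one {n : ℕ} : IsUnital (1 : Kernel n) := by simp [IsUnital]

lemma IsTP.one {n : ℕ} : IsTP (1 : Kernel n) := by simp [IsTP]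

lemma IsUnital.transpose {n : ℕ} {k : Kernel n} (hk : IsUnital k) : IsTP kᵀ := by
  rw [IsTP, Matrix.vecMul_transpose, hk]

lemma IsTP.transpose {n : ℕ} {k : Kernel n} (hk : IsTP k) : IsUnital kᵀ := by
  rw [IsUnital, Matrix.mulVec_transpose, hk]

/-- A product of local superoperators maps the identity to a product operator. -/
lemma loc_apply_one (K : (i : ι) → Kernel (d i)) (c c' : Idx d S) :
    loc K (1 : Op d S) c c' = ∏ i : {i // i ∈ S}, (K i.1 *ᵥ unitVec (d i.1)) (c i, c' i) := by
  simp only [loc_apply, mulVec_unitVec, ← sum_prod, Matrix.one_apply, mul_ite, mul_one, mul_zero,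
    Finset.sum_ite_eq, Finset.mem_univ, if_true]

lemma loc_one_eq_one {K : (i : ι) → Kernel (d i)} (h : ∀ i ∈ S, IsUnital (K i)) :
    loc K (1 : Op d S) = 1 := by
  ext c c'
  rw [loc_apply_one, Matrix.one_apply, ← prod_ite_eq_ite]
  refine Finset.prod_congr rfl fun i _ => ?_
  rw [h i.1 i.2, unitVec]

lemma sum_prod_of_TP {K : (i : ι) → Kernel (d i)} (h : ∀ i ∈ S, IsTP (K i)) (a a' : Idx d S) :
    ∑ c : Idx d S, ∏ i, K i.1 (c i, c i) (a i, a' i) = if a = a' then 1 else 0 := by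
  rw [sum_prod (fun i j => K i.1 (j, j) (a i, a' i)), ← prod_ite_eq_ite]
  refine Finset.prod_congr rfl fun i _ => ?_
  rw [← unitVec_vecMul, h i.1 i.2, unitVec]

lemma trace_loc {K : (i : ι) → Kernel (d i)} (h : ∀ i ∈ S, IsTP (K i)) (M : Op d S) :
    (loc K M).trace = M.trace := by
  simp only [Matrix.trace, Matrix.diag, loc_apply]
  rw [Finset.sum_comm]
  refine Finset.sum_congr rfl fun a _ => ?_
  rw [Finset.sum_comm]
  simp only [← Finset.sum_mul, sum_prod_of_TP h, ite_mul, one_mul, zero_mul, Finset.sum_ite_eq,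
    Finset.mem_univ, if_true]

lemma loc_merge (h : S ⊆ U ∪ V) (hU : U ⊆ S) (hV : V ⊆ S) (hd : Disjoint U V)
    (K : (i : ι) → Kernel (d i)) (M : Op d S) (a a' : Idx d U) (b b' : Idx d V) :
    loc K M (merge h a b) (merge h a' b') =
      ∑ u, ∑ v, ∑ u', ∑ v', ((∏ i, K i.1 (a i, a' i) (u i, u' i)) *
        ∏ i, K i.1 (b i, b' i) (v i, v' i)) * M (merge h u v) (merge h u' v') := by
  rw [loc_apply, sum_split h hU hV hd]
  refine Finset.sum_congr rfl fun u _ => Finset.sum_congr rfl fun v _ => ?_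
  rw [sum_split h hU hV hd]
  refine Finset.sum_congr rfl fun u' _ => Finset.sum_congr rfl fun v' _ => ?_
  rw [prod_split h hU hV hd]
  simp only [merge_left h hU _ _ _ (Subtype.prop _), merge_right h hV hd _ _ _ (Subtype.prop _)]

end Local

/-! ### Inputs and outputs of an arrow type -/

namespace QType

variable {ι : Type u} [DecidableEq ι]

lemma exists_mentions_iff (x : QType ι) (A : ι) :
    (∃ t ∈ x.word, t.mentions A = true) ↔ A ∈ x.systems := by
  induction x with
  | ele S => simp [word, systems, Token.mentions]
  | arr x y hx hy =>
    simp only [word, systems, List.mem_append, List.mem_singleton, Finset.mem_union, ← hx, ← hy]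
    constructor
    · rintro ⟨t, (((rfl | h) | rfl) | h) | rfl, ht⟩
      · simp [Token.mentions] at ht
      · exact Or.inl ⟨t, h, ht⟩
      · simp [Token.mentions] at ht
      · exact Or.inr ⟨t, h, ht⟩
      · simp [Token.mentions] at ht
    · rintro (⟨t, h, ht⟩ | ⟨t, h, ht⟩)
      · exact ⟨t, by tauto, ht⟩
      · exact ⟨t, by tauto, ht⟩

lemma dropWhile_eq_nil_iff (x : QType ι) (A : ι) :
    x.word.dropWhile (fun t => !(t.mentions A)) = [] ↔ A ∉ x.systems := by
  rw [List.dropWhile_eq_nil_iff, ← exists_mentions_iff]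
  simp

/-- Every arrow comes with one open bracket. -/
lemma countP_word_mod_two (x : QType ι) : x.word.countP Token.isArrowOrOpen % 2 = 0 := by
  induction x with
  | ele S => simp [word, Token.isArrowOrOpen]
  | arr x y hx hy =>
    simp only [word, List.countP_append, List.countP_singleton, Token.isArrowOrOpen, if_true]
    simp
    omega

lemma K_arr_left (x y : QType ι) {A : ι} (hA : A ∈ x.systems) :
    (arr x y).K A = (x.K A + 1) % 2 := by
  have h : x.word.dropWhile (fun t => !(t.mentions A)) ≠ [] := by
    rw [ne_eq, dropWhile_eq_nil_iff]; simpa using hA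
  have hy := countP_word_mod_two y
  simp only [K, word, List.append_assoc, List.cons_append, List.nil_append]
  rw [List.dropWhile_cons_of_pos (by simp [Token.mentions]), List.dropWhile_append,
    if_neg (by simpa using h)]
  simp only [List.countP_append, List.countP_cons, List.countP_nil, Token.isArrowOrOpen]
  simp
  omega

lemma K_arr_right (x y : QType ι) {A : ι} (hA : A ∉ x.systems) (hA' : A ∈ y.systems) :
    (arr x y).K A = y.K A := by
  have h : y.word.dropWhile (fun t => !(t.mentions A)) ≠ [] := by
    rw [ne_eq, dropWhile_eq_nil_iff]; simpa using hA'
  have hx : x.word.dropWhile (fun t => !(t.mentions A)) = [] := by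
    rwa [dropWhile_eq_nil_iff]
  simp only [K, word, List.append_assoc, List.cons_append, List.nil_append]
  rw [List.dropWhile_cons_of_pos (by simp [Token.mentions]), List.dropWhile_append,
    if_pos (by simpa using hx), List.dropWhile_cons_of_pos (by simp [Token.mentions]),
    List.dropWhile_append, if_neg (by simpa using h)]
  simp [List.countP_append, Token.isArrowOrOpen]

lemma ins_subset (x : QType ι) : x.ins ⊆ x.systems := Finset.filter_subset _ _

lemma outs_subset (x : QType ι) : x.outs ⊆ x.systems := Finset.sdiff_subset

lemma disjoint_ins_outs (x : QType ι) : Disjoint x.ins x.outs := Finset.disjoint_sdiff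

lemma systems_subset_ins_union_outs (x : QType ι) : x.systems ⊆ x.ins ∪ x.outs := by
  intro i hi
  simp only [outs, Finset.mem_union, Finset.mem_sdiff]
  tauto

lemma mem_outs_iff {x : QType ι} {i : ι} : i ∈ x.outs ↔ i ∈ x.systems ∧ i ∉ x.ins := by
  simp [outs]

lemma mem_ins_iff {x : QType ι} {i : ι} : i ∈ x.ins ↔ i ∈ x.systems ∧ i ∉ x.outs := by
  simp only [outs, Finset.mem_sdiff]
  have := @ins_subset _ _ x i
  tauto

@[simp] lemma ins_ele (S : Finset ι) : (ele S).ins = ∅ := by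
  refine Finset.filter_eq_empty_iff.mpr fun i hi => ?_
  have hi : i ∈ S := hi
  simp [K, word, Token.mentions, hi, Token.isArrowOrOpen]

@[simp] lemma outs_ele (S : Finset ι) : (ele S).outs = S := by simp [outs, systems]

lemma mem_ins_arr_left {x y : QType ι} {i : ι} (hi : i ∈ x.systems) :
    i ∈ (arr x y).ins ↔ i ∈ x.outs := by
  have h2 : x.K i < 2 := Nat.mod_lt _ (by norm_num)
  simp only [outs, ins, Finset.mem_filter, Finset.mem_sdiff, K_arr_left x y hi, systems,
    Finset.mem_union, hi, true_or, true_and]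
  omega

lemma mem_outs_arr_left {x y : QType ι} {i : ι} (hi : i ∈ x.systems) :
    i ∈ (arr x y).outs ↔ i ∈ x.ins := by
  have : i ∈ (arr x y).systems := Finset.mem_union_left _ hi
  rw [mem_outs_iff, mem_ins_arr_left hi, mem_ins_iff]
  tauto

lemma mem_ins_arr_right {x y : QType ι} (h : (arr x y).WellLabelled) {i : ι}
    (hi : i ∈ y.systems) : i ∈ (arr x y).ins ↔ i ∈ y.ins := by
  have hx : i ∉ x.systems := Finset.disjoint_right.mp h.2.2 hi
  simp only [ins, Finset.mem_filter, K_arr_right x y hx hi, systems, Finset.mem_union, hi, or_true]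

lemma mem_outs_arr_right {x y : QType ι} (h : (arr x y).WellLabelled) {i : ι}
    (hi : i ∈ y.systems) : i ∈ (arr x y).outs ↔ i ∈ y.outs := by
  have : i ∈ (arr x y).systems := Finset.mem_union_right _ hi
  rw [mem_outs_iff, mem_ins_arr_right h hi, mem_outs_iff]
  tauto

lemma outs_arr {x y : QType ι} (h : (arr x y).WellLabelled) :
    (arr x y).outs = x.ins ∪ y.outs := by
  ext i
  rw [Finset.mem_union]
  by_cases hx : i ∈ x.systems
  · have : i ∉ y.outs := fun hy => Finset.disjoint_left.mp h.2.2 hx (outs_subset _ hy)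
    rw [mem_outs_arr_left hx]; tauto
  · have h1 : i ∉ x.ins := fun h => hx (ins_subset _ h)
    by_cases hy : i ∈ y.systems
    · rw [mem_outs_arr_right h hy]; tauto
    · have h2 : i ∉ y.outs := fun h => hy (outs_subset _ h)
      have h3 : i ∉ (arr x y).outs := fun h => by
        simpa [systems, hx, hy] using outs_subset _ h
      tauto

lemma ins_arr {x y : QType ι} (h : (arr x y).WellLabelled) :
    (arr x y).ins = x.outs ∪ y.ins := by
  ext i
  rw [Finset.mem_union]
  by_cases hx : i ∈ x.systems
  · have : i ∉ y.ins := fun hy => Finset.disjoint_left.mp h.2.2 hx (ins_subset _ hy)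
    rw [mem_ins_arr_left hx]; tauto
  · have h1 : i ∉ x.outs := fun h => hx (outs_subset _ h)
    by_cases hy : i ∈ y.systems
    · rw [mem_ins_arr_right h hy]; tauto
    · have h2 : i ∉ y.ins := fun h => hy (ins_subset _ h)
      have h3 : i ∉ (arr x y).ins := fun h => by
        simpa [systems, hx, hy] using ins_subset _ h
      tauto

end QType

/-! ### Depolarization and superoperators on a single system -/

section Depol

variable {ι : Type u} [DecidableEq ι] {d : ι → ℕ} {S T U V : Finset ι}

/-- The kernel of the completely depolarizing map `M ↦ (Tr M / n) 1`. -/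
noncomputable def depolKernel (n : ℕ) : Kernel n :=
  (n : ℂ)⁻¹ • vecMulVec (unitVec n) (unitVec n)

lemma depolKernel_apply {n : ℕ} (p q : Fin n × Fin n) :
    depolKernel n p q = if p.1 = p.2 ∧ q.1 = q.2 then (n : ℂ)⁻¹ else 0 := by
  simp only [depolKernel, Matrix.smul_apply, vecMulVec_apply, unitVec]
  split_ifs <;> simp_all

lemma unitVec_dotProduct_self (n : ℕ) : unitVec n ⬝ᵥ unitVec n = n := by
  simp [dotProduct, unitVec, Fintype.sum_prod_type]

lemma depolKernel_transpose (n : ℕ) : (depolKernel n)ᵀ = depolKernel n := by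
  simp [depolKernel, transpose_vecMulVec]

lemma IsUnital.depolKernel {n : ℕ} (hn : 1 ≤ n) : IsUnital (depolKernel n) := by
  have : (n : ℂ) ≠ 0 := by exact_mod_cast (by omega : n ≠ 0)
  rw [IsUnital, HOQ.depolKernel, smul_mulVec, vecMulVec_mulVec, unitVec_dotProduct_self]
  ext p
  simp [mul_comm, this]

lemma IsTP.depolKernel {n : ℕ} (hn : 1 ≤ n) : IsTP (depolKernel n) := by
  have := (IsUnital.depolKernel hn).transpose
  rwa [depolKernel_transpose] at this

/-- The completely depolarizing map absorbs trace-preserving maps on its right. -/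
lemma depolKernel_mul {n : ℕ} {k : Kernel n} (hk : IsTP k) : depolKernel n * k = depolKernel n := by
  rw [depolKernel, Matrix.smul_mul, vecMulVec_mul, hk]

/-- The kernels of the map that depolarizes the systems in `U`. -/
noncomputable def depolKernels (d : ι → ℕ) (U : Finset ι) (i : ι) : Kernel (d i) :=
  if i ∈ U then depolKernel (d i) else 1

/-- Depolarization of the systems in `U`: trace them out and replace them by the maximally mixed
state. -/
noncomputable def depol (U : Finset ι) : Op d S →ₗ[ℂ] Op d S := loc (depolKernels d U)

lemma depolKernels_unital (U : Finset ι) {i : ι} (hi : 1 ≤ d i) :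
    IsUnital (depolKernels d U i) := by
  unfold depolKernels; split_ifs
  exacts [.depolKernel hi, .one]

lemma depolKernels_TP (U : Finset ι) {i : ι} (hi : 1 ≤ d i) : IsTP (depolKernels d U i) := by
  unfold depolKernels; split_ifs
  exacts [.depolKernel hi, .one]

lemma depolKernels_transpose (U : Finset ι) (i : ι) :
    (depolKernels d U i)ᵀ = depolKernels d U i := by
  unfold depolKernels; split_ifs
  exacts [depolKernel_transpose _, transpose_one]

lemma depol_congr (h : ∀ i ∈ S, i ∈ U ↔ i ∈ V) (M : Op d S) : depol U M = depol V M :=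
  loc_congr (fun i hi => by simp [depolKernels, h i hi]) M

lemma depol_depol (hd : ∀ i ∈ S, 1 ≤ d i) (U V : Finset ι) (M : Op d S) :
    depol U (depol V M) = depol (U ∪ V) M := by
  rw [depol, depol, loc_loc]
  refine loc_congr (fun i hi => ?_) M
  by_cases h1 : i ∈ U <;> by_cases h2 : i ∈ V <;> simp [depolKernels, h1, h2]
  exact depolKernel_mul (.depolKernel (hd i hi))

lemma depol_one (hd : ∀ i ∈ S, 1 ≤ d i) (U : Finset ι) : depol U (1 : Op d S) = 1 :=
  loc_one_eq_one fun i hi => depolKernels_unital U (hd i hi)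

lemma trace_depol (hd : ∀ i ∈ S, 1 ≤ d i) (U : Finset ι) (M : Op d S) :
    (depol U M).trace = M.trace :=
  trace_loc (fun i hi => depolKernels_TP U (hd i hi)) M

lemma depol_eq_self (h : Disjoint S U) (M : Op d S) : depol U M = M :=
  loc_eq_self (fun i hi => by simp [depolKernels, Finset.disjoint_left.mp h hi]) M

lemma prod_depolKernels (h : S ⊆ U) (c c' a a' : Idx d S) :
    ∏ i : {i // i ∈ S}, depolKernels d U i.1 (c i, c' i) (a i, a' i) =
      (dim d S)⁻¹ * (if c = c' then 1 else 0) * (if a = a' then 1 else 0) := by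
  rw [← prod_ite_eq_ite, ← prod_ite_eq_ite, dim, ← Finset.prod_inv_distrib,
    ← Finset.prod_mul_distrib, ← Finset.prod_mul_distrib]
  refine Finset.prod_congr rfl fun i _ => ?_
  simp only [depolKernels, h i.2, if_true, depolKernel_apply]
  split_ifs <;> simp_all

/-- Depolarizing all systems leaves only the trace. -/
lemma depol_all (h : S ⊆ U) (M : Op d S) : depol U M = (M.trace / dim d S) • (1 : Op d S) := by
  ext c c'
  rw [depol, loc_apply]
  simp only [prod_depolKernels h, Matrix.smul_apply, Matrix.one_apply, Matrix.trace, Matrix.diag,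
    smul_eq_mul, mul_ite, ite_mul, mul_one, mul_zero, zero_mul, Finset.sum_ite_eq, Finset.mem_univ,
    if_true]
  split_ifs
  · rw [Finset.sum_div]; exact Finset.sum_congr rfl fun _ _ => by ring
  · simp

lemma depol_conjTranspose (U : Finset ι) (M : Op d S) : depol U Mᴴ = (depol U M)ᴴ := by
  have key : ∀ i (p q : Fin (d i) × Fin (d i)),
      depolKernels d U i p q = star (depolKernels d U i (p.2, p.1) (q.2, q.1)) := by
    intro i p q
    unfold depolKernels
    split_ifs
    · simp only [depolKernel_apply, apply_ite star, star_zero, star_inv₀, star_natCast]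
      exact if_congr (by rw [eq_comm, eq_comm (a := q.1)]) rfl rfl
    · simp only [Matrix.one_apply, apply_ite star, star_zero, star_one]
      exact if_congr (by simp only [Prod.ext_iff, and_comm]) rfl rfl
  ext c c'
  rw [Matrix.conjTranspose_apply, depol, loc_apply, loc_apply, star_sum, Finset.sum_comm]
  refine Finset.sum_congr rfl fun a' _ => ?_
  rw [star_sum]
  refine Finset.sum_congr rfl fun a _ => ?_
  rw [star_mul', star_prod, Matrix.conjTranspose_apply]
  congr 1
  exact Finset.prod_congr rfl fun i _ => key _ _ _

/-- The superoperator with kernel `k` on the system `A`, extended by the identity. -/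
noncomputable def site (A : ι) (k : Kernel (d A)) : Op d S →ₗ[ℂ] Op d S :=
  loc (Function.update (fun _ => 1) A k)

lemma depol_singleton (A : ι) (M : Op d S) : depol {A} M = site A (depolKernel (d A)) M := by
  refine loc_congr (fun i _ => ?_) M
  by_cases h : i = A
  · subst h; simp [depolKernels]
  · simp [depolKernels, h]

lemma site_site (A : ι) (k l : Kernel (d A)) (M : Op d S) :
    site A k (site A l M) = site A (k * l) M := by
  rw [site, site, loc_loc]
  refine loc_congr (fun i _ => ?_) M
  by_cases h : i = A
  · subst h; simp
  · simp [h]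

lemma site_one (A : ι) (M : Op d S) : site A 1 M = M := by
  rw [site]
  refine loc_eq_self (fun i _ => ?_) M
  by_cases h : i = A
  · subst h; simp
  · simp [h]

/-- A superoperator on one system commutes with the depolarization of other systems. -/
lemma site_depol {A : ι} (hA : A ∉ U) (k : Kernel (d A)) (M : Op d S) :
    site A k (depol U M) = depol U (site A k M) := by
  rw [site, depol, loc_loc, loc_loc]
  refine loc_congr (fun i _ => ?_) M
  by_cases h : i = A
  · subst h; simp [depolKernels, hA]
  · simp [h]

lemma sum_ite_eq_update {i : {i // i ∈ S}} (c : Idx d S) (f : Idx d S → ℂ) :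
    ∑ a, (if a = Function.update c i (a i) then f a else 0) =
      ∑ j, f (Function.update c i j) := by
  have : ∀ j, f (Function.update c i j) = ∑ a, if a = Function.update c i j then f a else 0 :=
    fun j => by simp
  simp only [this]
  rw [Finset.sum_comm]
  refine Finset.sum_congr rfl fun a _ => ?_
  rw [Finset.sum_eq_single (a i)]
  · intro j _ hj
    rw [if_neg]
    rintro rfl
    simp at hj
  · simp

lemma site_apply {A : ι} (hA : A ∈ S) (k : Kernel (d A)) (M : Op d S) (c c' : Idx d S) :
    site A k M c c' = ∑ j, ∑ j', k (c ⟨A, hA⟩, c' ⟨A, hA⟩) (j, j') *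
      M (Function.update c ⟨A, hA⟩ j) (Function.update c' ⟨A, hA⟩ j') := by
  have key : ∀ a a' : Idx d S, ∏ i : {i // i ∈ S},
      (Function.update (fun _ => 1) A k : (i : ι) → Kernel (d i)) i.1 (c i, c' i) (a i, a' i) =
      if a = Function.update c ⟨A, hA⟩ (a ⟨A, hA⟩) then
        if a' = Function.update c' ⟨A, hA⟩ (a' ⟨A, hA⟩) then
          k (c ⟨A, hA⟩, c' ⟨A, hA⟩) (a ⟨A, hA⟩, a' ⟨A, hA⟩) else 0 else 0 := fun a a' => by
    rw [← Finset.mul_prod_erase _ _ (Finset.mem_univ (⟨A, hA⟩ : {i // i ∈ S}))]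
    have h1 : ∏ i ∈ Finset.univ.erase (⟨A, hA⟩ : {i // i ∈ S}),
        (Function.update (fun _ => 1) A k : (i : ι) → Kernel (d i)) i.1 (c i, c' i) (a i, a' i) =
        if ∀ i ∈ Finset.univ.erase (⟨A, hA⟩ : {i // i ∈ S}), c i = a i ∧ c' i = a' i
          then 1 else 0 := by
      trans ∏ i ∈ Finset.univ.erase (⟨A, hA⟩ : {i // i ∈ S}),
        if c i = a i ∧ c' i = a' i then (1 : ℂ) else 0
      · refine Finset.prod_congr rfl fun i hi => ?_
        have : i.1 ≠ A := fun h => (Finset.mem_erase.mp hi).1 (Subtype.ext h)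
        rw [Function.update_of_ne this, Matrix.one_apply]
        simp only [Prod.mk.injEq]
      · rw [Finset.prod_ite_zero, Finset.prod_const_one]
        split_ifs <;> rfl
    rw [h1]
    have h2 : (∀ i ∈ Finset.univ.erase (⟨A, hA⟩ : {i // i ∈ S}), c i = a i ∧ c' i = a' i) ↔
        a = Function.update c ⟨A, hA⟩ (a ⟨A, hA⟩) ∧
          a' = Function.update c' ⟨A, hA⟩ (a' ⟨A, hA⟩) := by
      simp only [Function.eq_update_iff, Finset.mem_erase, Finset.mem_univ, and_true, true_and,
        ne_eq]
      constructor
      · exact fun h => ⟨fun i hi => (h i hi).1.symm, fun i hi => (h i hi).2.symm⟩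
      · exact fun h i hi => ⟨(h.1 i hi).symm, (h.2 i hi).symm⟩
    simp only [h2, Function.update_self, mul_ite, mul_one, mul_zero, ite_and]
  set g : Idx d S → Idx d S → ℂ := fun a a' =>
    k (c ⟨A, hA⟩, c' ⟨A, hA⟩) (a ⟨A, hA⟩, a' ⟨A, hA⟩) * M a a' with hg
  trans ∑ j, ∑ j', g (Function.update c ⟨A, hA⟩ j) (Function.update c' ⟨A, hA⟩ j')
  · rw [← sum_ite_eq_update c fun a => ∑ j', g a (Function.update c' ⟨A, hA⟩ j'), site, loc_apply]
    refine Finset.sum_congr rfl fun a _ => ?_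
    rw [← sum_ite_eq_update c' fun a' => g a a']
    simp only [key, ite_mul, zero_mul, hg]
    split_ifs <;> simp
  · simp [hg]

lemma site_add {A : ι} (hA : A ∈ S) (k l : Kernel (d A)) (M : Op d S) :
    site A (k + l) M = site A k M + site A l M := by
  ext c c'
  simp only [Matrix.add_apply, site_apply hA, add_mul, Finset.sum_add_distrib]

lemma site_sub {A : ι} (hA : A ∈ S) (k l : Kernel (d A)) (M : Op d S) :
    site A (k - l) M = site A k M - site A l M := by
  rw [eq_sub_iff_add_eq, ← site_add hA, sub_add_cancel]

end Depol

/-! ### The affine space of deterministic maps -/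

section Affine

variable {ι : Type u} [DecidableEq ι] {d : ι → ℕ} {S T U V : Finset ι}

/-- The value at `R` of the linear map with Choi operator `M`, as a bilinear map. -/
noncomputable def choiApply : Op d (S ∪ T) →ₗ[ℂ] Op d S →ₗ[ℂ] Op d T :=
  LinearMap.mk₂ ℂ (fun M R => Matrix.of fun p q => ∑ a : Idx d S, ∑ a' : Idx d S,
      R a a' * M (merge (Finset.Subset.refl (S ∪ T)) a p) (merge (Finset.Subset.refl (S ∪ T)) a' q))
    (fun _ _ _ => by
      ext; simp only [Matrix.of_apply, Matrix.add_apply, mul_add, Finset.sum_add_distrib])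
    (fun _ _ _ => by
      ext; simp only [Matrix.of_apply, Matrix.smul_apply, smul_eq_mul, Finset.mul_sum,
        mul_left_comm])
    (fun _ _ _ => by
      ext; simp only [Matrix.of_apply, Matrix.add_apply, add_mul, Finset.sum_add_distrib])
    (fun _ _ _ => by
      ext; simp only [Matrix.of_apply, Matrix.smul_apply, smul_eq_mul, Finset.mul_sum,
        mul_assoc])

lemma choiApply_apply (M : Op d (S ∪ T)) (R : Op d S) (p q : Idx d T) :
    choiApply M R p q = ∑ a : Idx d S, ∑ a' : Idx d S,
      R a a' * M (merge (Finset.Subset.refl (S ∪ T)) a p)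
        (merge (Finset.Subset.refl (S ∪ T)) a' q) := rfl

lemma sum_comm_two_two {α β γ δ : Type*} [Fintype α] [Fintype β] [Fintype γ] [Fintype δ]
    (f : α → β → γ → δ → ℂ) :
    ∑ a, ∑ b, ∑ c, ∑ e, f a b c e = ∑ c, ∑ e, ∑ a, ∑ b, f a b c e := by
  rw [Finset.sum_congr rfl fun a _ => Finset.sum_comm, Finset.sum_comm]
  refine Finset.sum_congr rfl fun c _ => ?_
  rw [Finset.sum_congr rfl fun a _ => Finset.sum_comm, Finset.sum_comm]

/-- A local superoperator on a Choi operator acts after the map on the output side and, transposed,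
before the map on the input side. -/
lemma choiApply_loc (hST : Disjoint S T) (K : (i : ι) → Kernel (d i)) (M : Op d (S ∪ T))
    (R : Op d S) :
    choiApply (loc K M) R = loc K (choiApply M (loc (fun i => (K i)ᵀ) R)) := by
  ext p q
  simp only [choiApply_apply, loc_merge _ Finset.subset_union_left Finset.subset_union_right hST,
    loc_apply, Finset.mul_sum, Finset.sum_mul, Matrix.transpose_apply]
  have h : ∀ f : Idx d S → Idx d T → Idx d S → Idx d T → ℂ,
      ∑ u, ∑ v, ∑ u', ∑ v', f u v u' v' = ∑ v, ∑ v', ∑ u, ∑ u', f u v u' v' := by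
    intro f
    rw [Finset.sum_comm]
    refine Finset.sum_congr rfl fun v _ => ?_
    rw [Finset.sum_congr rfl fun u _ => Finset.sum_comm, Finset.sum_comm]
  rw [Finset.sum_congr rfl fun a _ => Finset.sum_congr rfl fun a' _ => h _, sum_comm_two_two]
  refine Finset.sum_congr rfl fun v _ => Finset.sum_congr rfl fun v' _ => ?_
  rw [sum_comm_two_two]
  refine Finset.sum_congr rfl fun u _ => Finset.sum_congr rfl fun u' _ =>
    Finset.sum_congr rfl fun a _ => Finset.sum_congr rfl fun a' _ => ?_
  ring

lemma choiApply_ext {M N : Op d (S ∪ T)} (hST : Disjoint S T)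
    (h : ∀ R, choiApply M R = choiApply N R) : M = N := by
  ext c c'
  have hc := fun c : Idx d (S ∪ T) => merge_restrict (Finset.Subset.refl (S ∪ T))
    Finset.subset_union_left Finset.subset_union_right hST c
  have := congrFun (congrFun (h (Matrix.single (restrict Finset.subset_union_left c)
    (restrict Finset.subset_union_left c') 1)) (restrict Finset.subset_union_right c))
    (restrict Finset.subset_union_right c')
  simpa [choiApply_apply, Matrix.single_apply, ite_and, hc] using this

lemma trace_choiApply_one (hST : Disjoint S T) (M : Op d (S ∪ T)) :
    (choiApply M 1).trace = M.trace := by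
  simp only [Matrix.trace, Matrix.diag, choiApply_apply, Matrix.one_apply, ite_mul, one_mul,
    zero_mul, Finset.sum_ite_eq, Finset.mem_univ, if_true]
  rw [Finset.sum_comm, sum_split (Finset.Subset.refl (S ∪ T)) Finset.subset_union_left
    Finset.subset_union_right hST]

lemma choiApply_one (hST : Disjoint S T) (R : Op d S) :
    choiApply (1 : Op d (S ∪ T)) R = R.trace • (1 : Op d T) := by
  ext p q
  simp only [choiApply_apply, Matrix.one_apply, Matrix.smul_apply, smul_eq_mul, Matrix.trace,
    Matrix.diag, merge_inj _ Finset.subset_union_left Finset.subset_union_right hST, ite_and,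
    mul_ite, mul_one, mul_zero]
  simp [Finset.sum_ite_irrel]

lemma choiApply_conjTranspose (M : Op d (S ∪ T)) (R : Op d S) :
    choiApply Mᴴ R = (choiApply M Rᴴ)ᴴ := by
  ext p q
  simp only [choiApply_apply, Matrix.conjTranspose_apply, star_sum, star_mul', star_star]
  exact Finset.sum_comm

/-- The affine space spanned by the deterministic maps of type `x`: operators of trace one for an
elementary type, and Choi operators of maps between these affine spaces for an arrow type. -/
def affineDet (d : ι → ℕ) : (x : QType ι) → Set (Op d x.systems)
  | .ele S => {M : Op d S | M.trace = 1}
  | .arr x y => {M : Op d (x.systems ∪ y.systems) |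
      ∀ R ∈ affineDet d x, choiApply M R ∈ affineDet d y}

lemma mem_affineDet_ele {S : Finset ι} {M : Op d (QType.ele S).systems} :
    M ∈ affineDet d (.ele S) ↔ M.trace = 1 := Iff.rfl

lemma mem_affineDet_arr {x y : QType ι} {M : Op d (x.systems ∪ y.systems)} :
    M ∈ affineDet d (.arr x y) ↔ ∀ R ∈ affineDet d x, choiApply M R ∈ affineDet d y := Iff.rfl

lemma affineDet_add_smul_sub (x : QType ι) {P Q R : Op d x.systems} (hP : P ∈ affineDet d x)
    (hQ : Q ∈ affineDet d x) (hR : R ∈ affineDet d x) (t : ℂ) :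
    P + t • (Q - R) ∈ affineDet d x := by
  induction x with
  | ele S =>
    rw [mem_affineDet_ele] at *
    rw [Matrix.trace_add, Matrix.trace_smul, Matrix.trace_sub, hP, hQ, hR]
    simp
  | arr x y _ hy =>
    refine mem_affineDet_arr.mpr fun W hW => ?_
    refine Set.mem_of_eq_of_mem ?_ (hy (hP W hW) (hQ W hW) (hR W hW))
    exact (by simp : ∀ P Q R : Op d (x.systems ∪ y.systems), choiApply (P + t • (Q - R)) W =
      choiApply P W + t • (choiApply Q W - choiApply R W)) P Q R

lemma affineDet_conjTranspose (x : QType ι) {P : Op d x.systems} (hP : P ∈ affineDet d x) :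
    Pᴴ ∈ affineDet d x := by
  induction x with
  | ele S =>
    rw [mem_affineDet_ele] at *
    rw [Matrix.trace_conjTranspose, hP, star_one]
  | arr x y hx hy =>
    refine mem_affineDet_arr.mpr fun W hW => ?_
    exact Set.mem_of_eq_of_mem (choiApply_conjTranspose _ _) (hy (hP _ (hx hW)))

/-- Local superoperators that preserve the identity and the trace preserve determinism. -/
lemma loc_mem_affineDet (x : QType ι) (hx : x.WellLabelled) {K : (i : ι) → Kernel (d i)}
    (hU : ∀ i ∈ x.systems, IsUnital (K i)) (hT : ∀ i ∈ x.systems, IsTP (K i))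
    {M : Op d x.systems} (hM : M ∈ affineDet d x) : loc K M ∈ affineDet d x := by
  induction x generalizing K with
  | ele S =>
    rw [mem_affineDet_ele] at *
    rw [trace_loc hT, hM]
  | arr x y ihx ihy =>
    refine mem_affineDet_arr.mpr fun W hW => ?_
    refine Set.mem_of_eq_of_mem (choiApply_loc hx.2.2 _ _ _) ?_
    refine ihy hx.2.1 (fun i hi => hU i (Finset.mem_union_right _ hi))
      (fun i hi => hT i (Finset.mem_union_right _ hi)) (hM _ (ihx hx.1 ?_ ?_ hW))
    · exact fun i hi => (hT i (Finset.mem_union_left _ hi)).transpose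
    · exact fun i hi => (hU i (Finset.mem_union_left _ hi)).transpose

lemma depol_mem_affineDet (x : QType ι) (hx : x.WellLabelled) (hd : ∀ i ∈ x.systems, 1 ≤ d i)
    (U : Finset ι) {M : Op d x.systems} (hM : M ∈ affineDet d x) : depol U M ∈ affineDet d x :=
  loc_mem_affineDet x hx (fun i hi => depolKernels_unital U (hd i hi))
    (fun i hi => depolKernels_TP U (hd i hi)) hM

lemma choiApply_depol (hST : Disjoint S T) (U : Finset ι) (M : Op d (S ∪ T)) (R : Op d S) :
    choiApply (depol U M) R = depol U (choiApply M (depol U R)) := by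
  rw [depol, choiApply_loc hST]
  simp only [depolKernels_transpose]
  rfl

lemma dim_systems (x : QType ι) : dim d x.systems = dim d x.ins * dim d x.outs :=
  dim_split x.systems_subset_ins_union_outs x.ins_subset x.outs_subset x.disjoint_ins_outs

lemma dim_disjUnion (h : Disjoint U V) : dim d (U ∪ V) = dim d U * dim d V :=
  dim_split (Finset.Subset.refl _) Finset.subset_union_left Finset.subset_union_right h

/-- Tracing out the outputs of a deterministic map gives the identity on the inputs, and every
operator of this normalization that is the identity on the inputs is deterministic. The two
statements need each other, because an arrow exchanges the inputs and outputs of its domain. -/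
lemma affineDet_ins_outs (x : QType ι) (hx : x.WellLabelled) (hd : ∀ i ∈ x.systems, 1 ≤ d i) :
    (∀ M ∈ affineDet d x, depol x.outs M = (dim d x.outs)⁻¹ • (1 : Op d x.systems)) ∧
    ∀ W : Op d x.systems, W.trace = dim d x.ins → depol x.ins W ∈ affineDet d x := by
  induction x with
  | ele S =>
    constructor
    · intro M hM
      rw [mem_affineDet_ele] at hM
      rw [QType.outs_ele]
      refine (depol_all (Finset.Subset.refl _) M).trans ?_
      rw [hM, one_div]
      rfl
    · intro W hW
      rw [mem_affineDet_ele]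
      refine (trace_depol hd _ W).trans (hW.trans ?_)
      rw [QType.ins_ele]; rfl
  | arr x y ihx ihy =>
    have hdx : ∀ i ∈ x.systems, 1 ≤ d i := fun i hi => hd i (Finset.mem_union_left _ hi)
    have hdy : ∀ i ∈ y.systems, 1 ≤ d i := fun i hi => hd i (Finset.mem_union_right _ hi)
    obtain ⟨x1, x2⟩ := ihx hx.1 hdx
    obtain ⟨y1, y2⟩ := ihy hx.2.1 hdy
    have nx : ∀ {U : Finset ι}, U ⊆ x.systems → dim d U ≠ 0 := fun hU =>
      dim_ne_zero fun i hi => hdx i (hU hi)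
    constructor
    · intro M hM
      have key : ∀ R : Op d x.systems, R.trace = dim d x.ins →
          choiApply (depol (QType.arr x y).outs M) R = (dim d y.outs)⁻¹ • (1 : Op d y.systems) := by
        intro R hR
        have h1 : choiApply (depol (QType.arr x y).outs M) R =
            depol (QType.arr x y).outs (choiApply M (depol (QType.arr x y).outs R)) :=
          choiApply_depol hx.2.2 _ _ _
        rw [h1, depol_congr (fun i hi => QType.mem_outs_arr_left hi) R,
          depol_congr (fun i hi => QType.mem_outs_arr_right hx hi)]
        exact y1 _ (hM _ (x2 R hR))
      have key2 : ∀ R : Op d x.systems, R.trace ≠ 0 →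
          choiApply (depol (QType.arr x y).outs M) R =
            choiApply ((dim d (QType.arr x y).outs)⁻¹ • (1 : Op d (x.systems ∪ y.systems))) R := by
        intro R hR
        have h2 := key ((dim d x.ins / R.trace) • R) (by
          rw [Matrix.trace_smul, smul_eq_mul]; field_simp)
        rw [map_smul] at h2
        have hx' := nx x.ins_subset
        have h3 := congrArg (fun Z => (R.trace / dim d x.ins) • Z) h2
        simp only [smul_smul] at h3
        rw [div_mul_div_cancel₀ hx', div_self hR, one_smul] at h3
        rw [h3, map_smul, LinearMap.smul_apply, choiApply_one hx.2.2, smul_smul, QType.outs_arr hx,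
          dim_disjUnion (hx.2.2.mono x.ins_subset y.outs_subset), mul_inv]
        congr 1
        ring
      refine choiApply_ext hx.2.2 fun R => ?_
      by_cases hR : R.trace = 0
      · -- an operator of trace zero is the difference of two operators of non-zero trace
        have h1 : (1 : Op d x.systems).trace ≠ 0 := by
          rw [trace_one_Idx]; exact nx (Finset.Subset.refl _)
        have h4 := key2 (R + 1) (by rwa [Matrix.trace_add, hR, zero_add])
        rw [map_add, map_add, key2 1 h1] at h4
        exact add_right_cancel h4
      · exact key2 R hR
    · intro W hW
      refine mem_affineDet_arr.mpr fun R hR => ?_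
      have h1 : choiApply (depol (QType.arr x y).ins W) R =
          depol (QType.arr x y).ins (choiApply W (depol (QType.arr x y).ins R)) :=
        choiApply_depol hx.2.2 _ _ _
      refine Set.mem_of_eq_of_mem h1 ?_
      rw [depol_congr (fun i hi => QType.mem_ins_arr_left hi) R, x1 R hR,
        depol_congr (fun i hi => QType.mem_ins_arr_right hx hi)]
      refine y2 _ ?_
      have h2 := (trace_choiApply_one hx.2.2 W).trans hW
      rw [map_smul, Matrix.trace_smul, h2, QType.ins_arr hx,
        dim_disjUnion (hx.2.2.mono x.outs_subset y.ins_subset), smul_eq_mul]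
      have := nx x.outs_subset
      field_simp

lemma depol_outs_eq_of_mem {x : QType ι} (hx : x.WellLabelled) (hd : ∀ i ∈ x.systems, 1 ≤ d i)
    {M : Op d x.systems} (hM : M ∈ affineDet d x) :
    depol x.outs M = (dim d x.outs)⁻¹ • (1 : Op d x.systems) :=
  (affineDet_ins_outs x hx hd).1 M hM

lemma depol_ins_mem {x : QType ι} (hx : x.WellLabelled) (hd : ∀ i ∈ x.systems, 1 ≤ d i)
    {W : Op d x.systems} (hW : W.trace = dim d x.ins) : depol x.ins W ∈ affineDet d x :=
  (affineDet_ins_outs x hx hd).2 W hW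

lemma smul_one_mem_affineDet {x : QType ι} (hx : x.WellLabelled)
    (hd : ∀ i ∈ x.systems, 1 ≤ d i) :
    (dim d x.outs)⁻¹ • (1 : Op d x.systems) ∈ affineDet d x := by
  have h := depol_ins_mem hx hd (W := (dim d x.outs)⁻¹ • (1 : Op d x.systems)) (by
    have : dim d x.outs ≠ 0 := dim_ne_zero fun i hi => hd i (x.outs_subset hi)
    rw [Matrix.trace_smul, trace_one_Idx, dim_systems, smul_eq_mul]
    field_simp)
  rwa [map_smul, depol_one hd] at h

end Affine

/-! ### Positivity -/

section Positivity

variable {n m p : Type*} [Fintype n] [Fintype m] [Fintype p]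

/-- Small Hermitian perturbations of a positive multiple of the identity are positive. -/
lemma exists_pos_perturbation [DecidableEq n] {H : Matrix n n ℂ} (hH : H.IsHermitian) {m : ℝ}
    (hm : 0 < m) :
    ∃ ε : ℝ, 0 < ε ∧ ∀ t : ℝ, |t| ≤ ε →
      ((m : ℂ) • (1 : Matrix n n ℂ) + (t : ℂ) • H).PosSemidef := by
  set c : ℝ := 1 + ∑ i, |hH.eigenvalues i| with hc
  have hle : ∀ i, |hH.eigenvalues i| ≤ c := fun i => by
    have := Finset.single_le_sum (f := fun i => |hH.eigenvalues i|)
      (fun i _ => abs_nonneg _) (Finset.mem_univ i)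
    linarith
  have hc0 : 0 < c := by
    have := Finset.sum_nonneg (s := Finset.univ) fun i _ => abs_nonneg (hH.eigenvalues i)
    linarith
  refine ⟨m / c, by positivity, fun t ht => ?_⟩
  have key : (m : ℂ) • (1 : Matrix n n ℂ) + (t : ℂ) • H =
      Unitary.conjStarAlgAut ℂ _ hH.eigenvectorUnitary
        (diagonal fun i => ((m + t * hH.eigenvalues i : ℝ) : ℂ)) := by
    have h1 : (diagonal fun i => ((m + t * hH.eigenvalues i : ℝ) : ℂ)) =
        (m : ℂ) • (1 : Matrix n n ℂ) +
          (t : ℂ) • diagonal (RCLike.ofReal ∘ hH.eigenvalues) := by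
      ext i j
      by_cases h : i = j
      · subst h; simp
      · simp [h]
    rw [h1, map_add, map_smul, map_smul, map_one, ← hH.spectral_theorem]
  rw [key, Unitary.conjStarAlgAut_apply]
  refine PosSemidef.mul_mul_conjTranspose_same (PosSemidef.diagonal fun i => ?_) _
  have h2 : |t * hH.eigenvalues i| ≤ m := by
    rw [abs_mul]
    calc |t| * |hH.eigenvalues i| ≤ m / c * c :=
          mul_le_mul ht (hle i) (abs_nonneg _) (by positivity)
      _ = m := div_mul_cancel₀ _ hc0.ne'
  have h3 : 0 ≤ m + t * hH.eigenvalues i := by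
    have := neg_abs_le (t * hH.eigenvalues i); linarith
  simpa using (by exact_mod_cast h3 : (0 : ℂ) ≤ ((m + t * hH.eigenvalues i : ℝ) : ℂ))

/-- Compression of a positive operator along an unnormalized pure state. -/
lemma posSemidef_sum_sum {N : Matrix (m × p) (m × p) ℂ} (hN : N.PosSemidef) :
    (Matrix.of fun i j => ∑ a, ∑ a', N (a, i) (a', j)).PosSemidef := by
  classical
  have := hN.conjTranspose_mul_mul_same (Matrix.of fun (z : m × p) (i : p) =>
    if z.2 = i then (1 : ℂ) else 0)
  convert this using 1
  ext i j
  simp only [Matrix.mul_apply, Matrix.conjTranspose_apply, Matrix.of_apply, Fintype.sum_prod_type,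
    apply_ite star, star_one, star_zero, ite_mul, one_mul, zero_mul, mul_ite,
    mul_one, mul_zero, Finset.sum_ite_eq', Finset.mem_univ, if_true]
  exact Finset.sum_comm

lemma posSemidef_smul_ofReal {N : Matrix n n ℂ} (hN : N.PosSemidef) {t : ℝ} (ht : 0 ≤ t) :
    ((t : ℂ) • N).PosSemidef :=
  hN.smul (by exact_mod_cast ht)

lemma posSemidef_finsetSum {k : ℕ} {N : Fin k → Matrix n n ℂ} (h : ∀ i, (N i).PosSemidef) :
    (∑ i, N i).PosSemidef := by
  refine Finset.sum_induction N _ (fun _ _ => PosSemidef.add) PosSemidef.zero fun i _ => h i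

end Positivity

/-! ### Deterministic maps are the positive operators in the affine space -/

section Characterization

variable {ι : Type u} [DecidableEq ι] {d : ι → ℕ} {S T U V : Finset ι} {E F : Type u}

/-- Partial trace over the additional system. -/
noncomputable def traceRight [Fintype E] : XOp d S E →ₗ[ℂ] Op d S where
  toFun M := Matrix.of fun c c' => ∑ e, M (c, e) (c', e)
  map_add' _ _ := by
    ext; simp only [Matrix.of_apply, Matrix.add_apply, Finset.sum_add_distrib]
  map_smul' _ _ := by
    ext; simp only [Matrix.of_apply, Matrix.smul_apply, Finset.smul_sum, RingHom.id_apply]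

lemma traceRight_apply [Fintype E] (M : XOp d S E) (c c' : Idx d S) :
    traceRight M c c' = ∑ e, M (c, e) (c', e) := rfl

lemma trace_traceRight [Fintype E] (M : XOp d S E) : (traceRight M).trace = M.trace := by
  simp only [Matrix.trace, Matrix.diag, traceRight_apply, Fintype.sum_prod_type]

lemma traceRight_act [Fintype E] [Fintype F] (M : XOp d (S ∪ T) E) (R : XOp d S F) :
    traceRight (act M R) = choiApply (traceRight M) (traceRight R) := by
  ext p q
  simp only [traceRight_apply, choiApply_apply, act, Fintype.sum_prod_type, Finset.sum_mul_sum]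
  rw [Finset.sum_congr rfl fun e _ => Finset.sum_comm, Finset.sum_comm]
  refine Finset.sum_congr rfl fun a _ => ?_
  rw [Finset.sum_congr rfl fun e _ => Finset.sum_comm, Finset.sum_comm]
  refine Finset.sum_congr rfl fun a' _ => ?_
  rw [Finset.sum_comm]

lemma act_add (M : XOp d (S ∪ T) E) (R R' : XOp d S F) :
    act M (R + R') = act M R + act M R' := by
  ext p q
  simp only [act, Matrix.add_apply, add_mul, Finset.sum_add_distrib]

lemma add_act (M M' : XOp d (S ∪ T) E) (R : XOp d S F) :
    act (M + M') R = act M R + act M' R := by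
  ext p q
  simp only [act, Matrix.add_apply, mul_add, Finset.sum_add_distrib]

lemma act_smul (M : XOp d (S ∪ T) E) (t : ℂ) (R : XOp d S F) : act M (t • R) = t • act M R := by
  ext p q
  simp only [act, Matrix.smul_apply, smul_eq_mul, mul_assoc, Finset.mul_sum]

lemma act_posSemidef [Fintype E] [Fintype F] {M : XOp d (S ∪ T) E} {R : XOp d S F}
    (hM : M.PosSemidef) (hR : R.PosSemidef) : (act M R).PosSemidef := by
  have h1 := hR.submatrix fun z : Idx d S × Idx d T × E × F => (z.1, z.2.2.2)
  have h2 := hM.submatrix fun z : Idx d S × Idx d T × E × F =>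
    (merge (Finset.Subset.refl (S ∪ T)) z.1 z.2.1, z.2.2.1)
  have h3 := posSemidef_sum_sum (h1.hadamard h2)
  convert h3 using 1
  ext p q
  simp only [act, Matrix.of_apply, Matrix.hadamard_apply, Matrix.submatrix_apply]

/-- The unnormalized maximally entangled state of the systems in `S` and a copy of them. -/
def maxEntangled (d : ι → ℕ) (S : Finset ι) : XOp d S (Idx d S) :=
  Matrix.of fun p q => if p.1 = p.2 ∧ q.1 = q.2 then 1 else 0

lemma maxEntangled_posSemidef : (maxEntangled d S).PosSemidef := by
  have := posSemidef_vecMulVec_self_star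
    (fun p : Idx d S × Idx d S => if p.1 = p.2 then (1 : ℂ) else 0)
  convert this using 1
  ext p q
  simp only [maxEntangled, Matrix.of_apply, vecMulVec_apply, Pi.star_apply]
  split_ifs <;> simp_all

/-- A map whose value at a maximally entangled state is positive has a positive Choi operator. -/
lemma posSemidef_of_act_maxEntangled (hST : Disjoint S T) {M : XOp d (S ∪ T) E}
    (h : (act M (maxEntangled d S)).PosSemidef) : M.PosSemidef := by
  have := h.submatrix fun z : Idx d (S ∪ T) × E =>
    (restrict Finset.subset_union_right z.1, (z.2, restrict Finset.subset_union_left z.1))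
  convert this using 1
  ext p q
  have hc := fun c : Idx d (S ∪ T) => merge_restrict (Finset.Subset.refl (S ∪ T))
    Finset.subset_union_left Finset.subset_union_right hST c
  simp [act, maxEntangled, ite_and, hc]

/-- A multiple of the identity, extended to an additional system, dominates a multiple of the
maximally entangled state. -/
lemma exists_smul_maxEntangled_le (x : QType ι) (hx : x.WellLabelled)
    (hd : ∀ i ∈ x.systems, 1 ≤ d i) :
    ∃ (ε : ℝ) (N : XOp d x.systems (Idx d x.systems)), 0 < ε ∧ N.PosSemidef ∧
      traceRight N ∈ affineDet d x ∧ (N - (ε : ℂ) • maxEntangled d x.systems).PosSemidef := by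
  have := nonempty_Idx hd
  set k : ℝ := ((∏ i : {i // i ∈ x.outs}, d i.1 : ℕ) : ℝ)⁻¹ *
    (Fintype.card (Idx d x.systems) : ℝ)⁻¹ with hk
  have hk0 : 0 < k := by
    refine mul_pos (inv_pos.mpr ?_) (inv_pos.mpr (by exact_mod_cast Fintype.card_pos))
    exact_mod_cast Finset.prod_pos fun (i : {i // i ∈ x.outs}) _ => hd i.1 (x.outs_subset i.2)
  obtain ⟨ε, hε, h⟩ := exists_pos_perturbation
    (maxEntangled_posSemidef (d := d) (S := x.systems)).isHermitian hk0
  refine ⟨ε, (k : ℂ) • 1, hε, posSemidef_smul_ofReal PosSemidef.one hk0.le, ?_, ?_⟩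
  · convert smul_one_mem_affineDet hx hd using 1
    have hne : (Fintype.card (Idx d x.systems) : ℂ) ≠ 0 := by exact_mod_cast Fintype.card_ne_zero
    have h1 : (k : ℂ) * Fintype.card (Idx d x.systems) = (dim d x.outs)⁻¹ := by
      rw [hk, dim_eq_natCast]; push_cast; field_simp
    rw [← h1]
    ext c c'
    simp only [traceRight_apply, Matrix.smul_apply, Matrix.one_apply, Prod.mk.injEq, and_true,
      smul_eq_mul, Finset.sum_const, Finset.card_univ, nsmul_eq_mul]
    ring
  · have := h (-ε) (by rw [abs_neg, abs_of_pos hε])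
    rwa [Complex.ofReal_neg, neg_smul, ← sub_eq_add_neg] at this

/-- An affine map that sends the positive operators of `affineDet d x` into `affineDet d y` sends
all of `affineDet d x` there, since multiples of the identity are interior points. -/
lemma choiApply_mem_of_posSemidef {x y : QType ι} (hx : x.WellLabelled)
    (hd : ∀ i ∈ x.systems, 1 ≤ d i) {M : Op d (x.systems ∪ y.systems)}
    (h : ∀ R ∈ affineDet d x, R.PosSemidef → choiApply M R ∈ affineDet d y)
    {R : Op d x.systems} (hR : R ∈ affineDet d x) : choiApply M R ∈ affineDet d y := by
  set k : ℝ := ((∏ i : {i // i ∈ x.outs}, d i.1 : ℕ) : ℝ)⁻¹ with hk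
  have hk0 : 0 < k := by
    refine inv_pos.mpr ?_
    exact_mod_cast Finset.prod_pos fun (i : {i // i ∈ x.outs}) _ => hd i.1 (x.outs_subset i.2)
  set L : Op d x.systems := (k : ℂ) • 1 with hL
  have hLmem : L ∈ affineDet d x := by
    convert smul_one_mem_affineDet hx hd using 2
    rw [hk, dim_eq_natCast]; push_cast; rfl
  have hLpos : L.PosSemidef := posSemidef_smul_ofReal PosSemidef.one hk0.le
  have hRs := affineDet_conjTranspose x hR
  -- real and imaginary part of the direction `R - L`
  have main : ∀ u : ℂ, ∃ t : ℝ, 0 < t ∧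
      L + (t : ℂ) • (u • (R - L) + star u • (Rᴴ - L)) ∈ affineDet d x ∧
      (L + (t : ℂ) • (u • (R - L) + star u • (Rᴴ - L))).PosSemidef := by
    intro u
    have hH : (u • (R - L) + star u • (Rᴴ - L)).IsHermitian := by
      have hL' : Lᴴ = L := hLpos.isHermitian
      rw [Matrix.IsHermitian, conjTranspose_add, conjTranspose_smul, conjTranspose_smul,
        conjTranspose_sub, conjTranspose_sub, conjTranspose_conjTranspose, hL', star_star,
        add_comm]
    obtain ⟨ε, hε, hp⟩ := exists_pos_perturbation hH hk0
    refine ⟨ε, hε, ?_, hp ε (abs_of_pos hε).le⟩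
    have h1 := affineDet_add_smul_sub x hLmem hR hLmem (ε * u)
    have h2 := affineDet_add_smul_sub x h1 hRs hLmem (ε * star u)
    convert h2 using 1
    rw [smul_add, smul_smul, smul_smul, add_assoc]
  obtain ⟨t₁, ht₁, m₁, p₁⟩ := main (1 / 2)
  obtain ⟨t₂, ht₂, m₂, p₂⟩ := main (-Complex.I / 2)
  have hc₁ : (t₁ : ℂ) ≠ 0 := by exact_mod_cast ht₁.ne'
  have hc₂ : (t₂ : ℂ) ≠ 0 := by exact_mod_cast ht₂.ne'
  have hLim := h L hLmem hLpos
  have g₁ := affineDet_add_smul_sub y hLim (h _ m₁ p₁) hLim (t₁ : ℂ)⁻¹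
  have g₂ := affineDet_add_smul_sub y g₁ (h _ m₂ p₂) hLim (Complex.I * (t₂ : ℂ)⁻¹)
  convert g₂ using 1
  rw [← map_sub, ← map_sub, ← map_smul, ← map_smul, ← map_add, ← map_add]
  congr 1
  rw [add_sub_cancel_left, add_sub_cancel_left, smul_smul, smul_smul, inv_mul_cancel₀ hc₁,
    mul_assoc, inv_mul_cancel₀ hc₂, one_smul, mul_one, smul_add, smul_smul, smul_smul]
  have e1 : Complex.I * (-Complex.I / 2) = 1 / 2 := by
    linear_combination (-1 / 2 : ℂ) * Complex.I_mul_I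
  have e2 : Complex.I * star (-Complex.I / 2) = -(1 / 2) := by
    simp only [Complex.star_def, map_div₀, map_neg, Complex.conj_I, neg_neg, map_ofNat]
    linear_combination (1 / 2 : ℂ) * Complex.I_mul_I
  have e3 : star (1 / 2 : ℂ) = 1 / 2 := by simp
  rw [e1, e2, e3]
  module

variable (d) in
/-- The Choi operator `M` maps the admissible maps of type `x ‖ F` to admissible maps, for every
additional system `F`. -/
def PreservesAdm (x y : QType ι) {E : Type u} [Fintype E]
    (M : XOp d (x.systems ∪ y.systems) E) : Prop :=
  ∀ (F : Type u) [Fintype F] [Nonempty F],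
    ∀ R ∈ (maps d x F).adm, act M R ∈ (maps d y (E × F)).adm

variable (d) in
/-- The Choi operator `M` maps the deterministic maps of type `x ‖ F` to deterministic maps, for
every additional system `F`. -/
def PreservesDet (x y : QType ι) {E : Type u} [Fintype E]
    (M : XOp d (x.systems ∪ y.systems) E) : Prop :=
  ∀ (F : Type u) [Fintype F] [Nonempty F],
    ∀ R ∈ (maps d x F).det, act M R ∈ (maps d y (E × F)).det

lemma mem_adm_arr {x y : QType ι} {E : Type u} [Fintype E]
    {M : XOp d (x.systems ∪ y.systems) E} : M ∈ (maps d (.arr x y) E).adm ↔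
      PreservesAdm d x y M ∧ ∃ (n : ℕ) (N : Fin n → XOp d (x.systems ∪ y.systems) E),
        (∀ i, PreservesAdm d x y (N i)) ∧ PreservesDet d x y (M + ∑ i, N i) := by
  simp only [maps]
  exact Iff.rfl

lemma mem_det_arr {x y : QType ι} {E : Type u} [Fintype E]
    {M : XOp d (x.systems ∪ y.systems) E} : M ∈ (maps d (.arr x y) E).det ↔
      M ∈ (maps d (.arr x y) E).adm ∧ PreservesDet d x y M := by
  simp only [maps]
  exact Iff.rfl

/-- The deterministic maps of type `x ‖ E` are the positive operators whose partial trace over `E`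
lies in `affineDet d x`, and the admissible maps are the positive operators below them. -/
theorem maps_characterization (x : QType ι) (hx : x.WellLabelled)
    (hd : ∀ i ∈ x.systems, 1 ≤ d i) (E : Type u) [Fintype E] [Nonempty E] :
    (∀ M : XOp d x.systems E,
      M ∈ (maps d x E).det ↔ M.PosSemidef ∧ traceRight M ∈ affineDet d x) ∧
    ∀ M : XOp d x.systems E,
      M ∈ (maps d x E).adm ↔ M.PosSemidef ∧ ∃ N ∈ (maps d x E).det, (N - M).PosSemidef := by
  induction x generalizing E with
  | ele S =>
    constructor
    · intro M
      rw [mem_affineDet_ele]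
      have : (traceRight M).trace = M.trace := trace_traceRight M
      rw [this]
      simp only [maps]
      exact Iff.rfl
    · intro M
      simp only [maps]
      exact Iff.rfl
  | arr x y ihx ihy =>
    have hdx : ∀ i ∈ x.systems, 1 ≤ d i := fun i hi => hd i (Finset.mem_union_left _ hi)
    have hdy : ∀ i ∈ y.systems, 1 ≤ d i := fun i hi => hd i (Finset.mem_union_right _ hi)
    have pos_of_preservesAdm : ∀ M : XOp d (x.systems ∪ y.systems) E,
        PreservesAdm d x y M → M.PosSemidef := by
      intro M hM
      have := nonempty_Idx hdx
      obtain ⟨ε, N, hε, hN, hN', hle⟩ := exists_smul_maxEntangled_le x hx.1 hdx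
      have h1 := hM (Idx d x.systems) ((ε : ℂ) • maxEntangled d x.systems)
        (((ihx hx.1 hdx _).2 _).mpr ⟨posSemidef_smul_ofReal maxEntangled_posSemidef hε.le, N,
          ((ihx hx.1 hdx _).1 _).mpr ⟨hN, hN'⟩, hle⟩)
      have h2 := posSemidef_smul_ofReal (((ihy hx.2.1 hdy _).2 _).mp h1).1 (inv_nonneg.mpr hε.le)
      rw [act_smul, smul_smul, Complex.ofReal_inv,
        inv_mul_cancel₀ (by exact_mod_cast hε.ne'), one_smul] at h2
      exact posSemidef_of_act_maxEntangled hx.2.2 h2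
    have preservesAdm_of_le : ∀ M N : XOp d (x.systems ∪ y.systems) E, M.PosSemidef →
        (N - M).PosSemidef → PreservesDet d x y N → PreservesAdm d x y M := by
      intro M N hM hMN hN F _ _ R hR
      obtain ⟨hR, R', hR', hRR'⟩ := ((ihx hx.1 hdx F).2 R).mp hR
      refine ((ihy hx.2.1 hdy _).2 _).mpr
        ⟨act_posSemidef hM hR, act N R', hN F R' hR', ?_⟩
      have h1 := act_posSemidef hM hRR'
      have h2 := act_posSemidef hMN (((ihx hx.1 hdx F).1 R').mp hR').1
      have e1 : act N R' = act M R' + act (N - M) R' := by rw [← add_act, add_sub_cancel]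
      have e2 : act M R' = act M R + act M (R' - R) := by rw [← act_add, add_sub_cancel]
      rw [e1, e2]
      convert h1.add h2 using 1
      abel
    have preservesDet_iff : ∀ M : XOp d (x.systems ∪ y.systems) E, M.PosSemidef →
        (PreservesDet d x y M ↔ ∀ R ∈ affineDet d x,
          choiApply (traceRight M) R ∈ affineDet d y) := by
      intro M hM
      constructor
      · intro h R hR
        refine choiApply_mem_of_posSemidef hx.1 hdx (fun R hR hR0 => ?_) hR
        have hR' : traceRight (R.submatrix Prod.fst Prod.fst :
            XOp d x.systems PUnit.{u + 1}) = R := by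
          ext c c'
          simp [traceRight_apply]
        have h1 := h PUnit (R.submatrix Prod.fst Prod.fst)
          (((ihx hx.1 hdx _).1 _).mpr ⟨hR0.submatrix _, by rwa [hR']⟩)
        have h2 := (((ihy hx.2.1 hdy _).1 _).mp h1).2
        rwa [traceRight_act, hR'] at h2
      · intro h F _ _ R hR
        obtain ⟨hR0, hR1⟩ := ((ihx hx.1 hdx F).1 R).mp hR
        refine ((ihy hx.2.1 hdy _).1 _).mpr ⟨act_posSemidef hM hR0, ?_⟩
        rw [traceRight_act]
        exact h _ hR1
    have det_iff : ∀ M : XOp d (x.systems ∪ y.systems) E, M ∈ (maps d (.arr x y) E).det ↔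
        M.PosSemidef ∧ PreservesDet d x y M := by
      intro M
      rw [mem_det_arr, mem_adm_arr]
      constructor
      · exact fun h => ⟨pos_of_preservesAdm M h.1.1, h.2⟩
      · rintro ⟨h1, h2⟩
        exact ⟨⟨preservesAdm_of_le M M h1 (by rw [sub_self]; exact PosSemidef.zero) h2,
          0, fun i => i.elim0, fun i => i.elim0, by simpa using h2⟩, h2⟩
    have adm_iff : ∀ M : XOp d (x.systems ∪ y.systems) E, M ∈ (maps d (.arr x y) E).adm ↔
        M.PosSemidef ∧ ∃ N : XOp d (x.systems ∪ y.systems) E,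
          (N.PosSemidef ∧ PreservesDet d x y N) ∧ (N - M).PosSemidef := by
      intro M
      rw [mem_adm_arr]
      constructor
      · rintro ⟨h1, n, N, h2, h3⟩
        have hM := pos_of_preservesAdm M h1
        have hN := posSemidef_finsetSum fun i => pos_of_preservesAdm _ (h2 i)
        exact ⟨hM, M + ∑ i, N i, ⟨hM.add hN, h3⟩, by rwa [add_sub_cancel_left]⟩
      · rintro ⟨hM, N, ⟨-, hN1⟩, hMN⟩
        refine ⟨preservesAdm_of_le M N hM hMN hN1, 1, fun _ => N - M, fun _ => ?_, ?_⟩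
        · exact preservesAdm_of_le (N - M) N hMN (by rwa [sub_sub_cancel]) hN1
        · rwa [Fin.sum_univ_one, add_sub_cancel]
    constructor
    · exact fun M => (det_iff M).trans (and_congr_right fun hM => preservesDet_iff M hM)
    · exact fun M => (adm_iff M).trans (and_congr_right fun _ => exists_congr fun N =>
        and_congr_left fun _ => (det_iff N).symm)

lemma isDeterministic_iff {x : QType ι} (hx : x.WellLabelled) (hd : ∀ i ∈ x.systems, 1 ≤ d i)
    {R : Op d x.systems} : IsDeterministic x R ↔ R.PosSemidef ∧ R ∈ affineDet d x := by
  have hR : traceRight (R.submatrix Prod.fst Prod.fst : XOp d x.systems PUnit.{u + 1}) = R := by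
    ext c c'
    simp [traceRight_apply]
  have h1 := ((maps_characterization x hx hd PUnit.{u + 1}).1
    (R.submatrix Prod.fst Prod.fst : XOp d x.systems PUnit.{u + 1}))
  rw [hR] at h1
  constructor
  · rintro ⟨_, h⟩
    obtain ⟨h2, h3⟩ := h1.mp h
    exact ⟨h2.submatrix fun c : Idx d x.systems => (c, PUnit.unit), h3⟩
  · rintro ⟨h2, h3⟩
    exact ⟨⟨Finset.Subset.refl _, Finset.Subset.refl _⟩, h1.mpr ⟨h2.submatrix _, h3⟩⟩

end Characterization

/-! ### No-signalling in terms of depolarization -/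

section NoSignalling

variable {ι : Type u} [DecidableEq ι] {d : ι → ℕ} {S U V : Finset ι}

lemma depol_merge (h : S ⊆ U ∪ V) (hU : U ⊆ S) (hV : V ⊆ S) (hd : Disjoint U V) (M : Op d S)
    (a a' : Idx d U) (b b' : Idx d V) :
    depol V M (merge h a b) (merge h a' b') =
      (dim d V)⁻¹ * (if b = b' then 1 else 0) * ptrace h M a a' := by
  have h1 : ∀ u u' : Idx d U, ∏ i : {i // i ∈ U}, depolKernels d V i.1 (a i, a' i) (u i, u' i) =
      if a = u ∧ a' = u' then 1 else 0 := fun u u' => by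
    rw [← prod_one_kernel]
    refine Finset.prod_congr rfl fun i _ => ?_
    rw [depolKernels, if_neg (Finset.disjoint_left.mp hd i.2)]
  rw [depol, loc_merge h hU hV hd]
  simp only [h1, prod_depolKernels (Finset.Subset.refl V), ite_and, ptrace]
  rw [Finset.sum_eq_single a (fun u _ hu => by simp [hu.symm]) (by simp), Finset.mul_sum]
  refine Finset.sum_congr rfl fun v _ => ?_
  rw [Finset.sum_eq_single a' (fun u _ hu => by simp [hu.symm]) (by simp),
    Finset.sum_eq_single v (fun v' _ hv => by simp [hv.symm]) (by simp)]
  simp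

lemma ptrace_loc (h : S ⊆ U ∪ V) (hU : U ⊆ S) (hV : V ⊆ S) (hd : Disjoint U V)
    {K : (i : ι) → Kernel (d i)} (hK : ∀ i ∈ V, IsTP (K i)) (M : Op d S) :
    ptrace h (loc K M) = loc K (ptrace h M) := by
  ext a a'
  rw [loc_apply]
  simp only [ptrace, loc_merge h hU hV hd, Finset.mul_sum]
  rw [Finset.sum_comm]
  refine Finset.sum_congr rfl fun u _ => ?_
  rw [Finset.sum_comm, Finset.sum_congr rfl fun v _ => Finset.sum_comm, Finset.sum_comm]
  refine Finset.sum_congr rfl fun u' _ => Finset.sum_congr rfl fun v _ => ?_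
  rw [Finset.sum_comm]
  simp only [← Finset.sum_mul, ← Finset.mul_sum, sum_prod_of_TP hK]
  rw [Finset.sum_eq_single v (fun v' _ hv => by simp [hv.symm]) (by simp)]
  simp

lemma exists_eq_tensor_one_iff {A : ι} (hA : A ∉ V) (hdA : 1 ≤ d A) (M : Op d ({A} ∪ V)) :
    (∃ R' : Op d V, M = tensor (1 : Op d {A}) R') ↔ depol {A} M = M := by
  have hd : Disjoint V {A} := by simpa using hA
  have h : {A} ∪ V ⊆ V ∪ {A} := by rw [Finset.union_comm]
  have hV : V ⊆ {A} ∪ V := Finset.subset_union_right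
  have hA' : {A} ⊆ {A} ∪ V := Finset.subset_union_left
  have hdim : dim d {A} ≠ 0 := dim_ne_zero (by simpa using hdA)
  have hc := fun c : Idx d ({A} ∪ V) => merge_restrict h hV hA' hd c
  constructor
  · rintro ⟨R', rfl⟩
    ext c c'
    rw [← hc c, ← hc c', depol_merge h hV hA' hd]
    simp only [ptrace, tensor, restrict_merge_left h hV, restrict_merge_right h hA' hd,
      Matrix.one_apply, if_true, one_mul, Finset.sum_const, Finset.card_univ, nsmul_eq_mul,
      card_Idx]
    field_simp
  · intro hM
    refine ⟨(dim d {A})⁻¹ • (ptrace h M : Op d V), ?_⟩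
    ext c c'
    have := congrFun (congrFun hM.symm (merge h (restrict hV c) (restrict hA' c)))
      (merge h (restrict hV c') (restrict hA' c'))
    rw [depol_merge h hV hA' hd, hc, hc] at this
    rw [this]
    simp only [tensor, Matrix.one_apply, Matrix.smul_apply, smul_eq_mul]
    ring

/-- No-signalling from `A` to `B` says that after the outputs other than `B` are depolarized,
depolarizing `A` has no further effect. -/
lemma mapNoSignalling_iff {x : QType ι} (hd : ∀ i ∈ x.systems, 1 ≤ d i) {A B : ι}
    (hA : A ∈ x.ins) (hB : B ∈ x.outs) (R : Op d x.systems) :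
    MapNoSignalling x A B R ↔
      depol {A} (depol (x.outs.erase B) R) = depol (x.outs.erase B) R := by
  have hAo : A ∉ x.outs := (QType.mem_ins_iff.mp hA).2
  have hAB : A ≠ B := fun h => hAo (h ▸ hB)
  have hAs : A ∈ x.systems := x.ins_subset hA
  set U := {A} ∪ (x.ins.erase A ∪ {B}) with hU
  set O := x.outs.erase B with hO
  have h : x.systems ⊆ U ∪ O := x.systems_subset A B
  have hUS : U ⊆ x.systems := by
    intro i hi
    simp only [hU, Finset.mem_union, Finset.mem_singleton, Finset.mem_erase] at hi
    rcases hi with rfl | ⟨-, hi⟩ | rfl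
    exacts [hAs, x.ins_subset hi, x.outs_subset hB]
  have hOS : O ⊆ x.systems := (Finset.erase_subset _ _).trans x.outs_subset
  have hUO : Disjoint U O := by
    rw [Finset.disjoint_left]
    intro i hi
    simp only [hU, Finset.mem_union, Finset.mem_singleton, Finset.mem_erase] at hi
    rw [hO, Finset.mem_erase, QType.mem_outs_iff]
    rcases hi with rfl | ⟨-, hi⟩ | rfl
    all_goals tauto
  have hN : A ∉ x.ins.erase A ∪ {B} := by simp [hAB]
  have hdim : dim d O ≠ 0 := dim_ne_zero fun i hi => hd i (hOS hi)
  have h1 : ptrace h (depol {A} R) = depol {A} (ptrace h R : Op d U) :=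
    ptrace_loc h hUS hOS hUO (fun i hi => depolKernels_TP _ (hd i (hOS hi))) R
  have h2 : depol {A} (depol O R) = depol O (depol {A} R) := by
    rw [depol_depol hd, depol_depol hd, Finset.union_comm]
  refine (exists_eq_tensor_one_iff (V := x.ins.erase A ∪ {B}) hN (hd A hAs) (ptrace h R)).trans ?_
  rw [h2, ← h1]
  have hne : Nonempty (Idx d O) := nonempty_Idx fun i hi => hd i (hOS hi)
  constructor
  · intro e
    ext c c'
    rw [← merge_restrict h hUS hOS hUO c, ← merge_restrict h hUS hOS hUO c',
      depol_merge h hUS hOS hUO, depol_merge h hUS hOS hUO, e]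
  · intro e
    ext a a'
    obtain ⟨b⟩ := hne
    have := congrFun (congrFun e (merge h a b)) (merge h a' b)
    rw [depol_merge h hUS hOS hUO, depol_merge h hUS hOS hUO] at this
    simp only [if_true, mul_one] at this
    exact mul_left_cancel₀ (inv_ne_zero hdim) this

end NoSignalling

/-! ### Contraction -/

section Contraction

variable {ι : Type u} [DecidableEq ι] {d : ι → ℕ} {S : Finset ι} {A B : ι}

/-- The systems that remain after the contraction of `A` and `B`. -/
abbrev rest (S : Finset ι) (A B : ι) : Finset ι := (S ∪ {A, B}) \ (S ∩ {A, B})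

lemma subset_rest_union : S ⊆ rest S A B ∪ (S ∩ {A, B}) := fun i hi => by
  simp only [rest, Finset.mem_union, Finset.mem_sdiff, Finset.mem_inter]; tauto

lemma rest_subset (hA : A ∈ S) (hB : B ∈ S) : rest S A B ⊆ S := fun i hi => by
  simp only [rest, Finset.mem_union, Finset.mem_sdiff, Finset.mem_inter, Finset.mem_insert,
    Finset.mem_singleton] at hi
  rcases hi.1 with h | rfl | rfl <;> assumption

lemma disjoint_rest : Disjoint (rest S A B) (S ∩ {A, B}) := Finset.sdiff_disjoint

lemma mem_rest (hA : A ∈ S) (hB : B ∈ S) {i : ι} :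
    i ∈ rest S A B ↔ i ∈ S ∧ i ≠ A ∧ i ≠ B := by
  simp only [rest, Finset.mem_union, Finset.mem_sdiff, Finset.mem_inter, Finset.mem_insert,
    Finset.mem_singleton]
  constructor
  · rintro ⟨h | rfl | rfl, h'⟩ <;> tauto
  · tauto

/-- The basis label `(j, j)` of the systems `A` and `B`. -/
def diagIdx (S : Finset ι) (hAB : d A = d B) (j : Fin (d A)) : Idx d (S ∩ {A, B}) := fun i =>
  Fin.cast (by
    have h := (Finset.mem_inter.mp i.2).2
    rcases Finset.mem_insert.mp h with h | h
    · rw [h]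
    · rw [Finset.mem_singleton.mp h, hAB]) j

/-- The basis label that agrees with `c` on the remaining systems and is `(j, j)` on `A` and
`B`. -/
def insertDiag (hAB : d A = d B) (c : Idx d (rest S A B)) (j : Fin (d A)) : Idx d S :=
  merge subset_rest_union c (diagIdx S hAB j)

lemma diagIdx_injective (hA : A ∈ S) (hAB : d A = d B) :
    Function.Injective (diagIdx S hAB) := fun j j' h => by
  have := congrFun h ⟨A, by simp [hA]⟩
  simpa [diagIdx] using this

lemma insertDiag_inj (hA : A ∈ S) (hB : B ∈ S) (hAB : d A = d B) {c c' : Idx d (rest S A B)}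
    {j j' : Fin (d A)} : insertDiag hAB c j = insertDiag hAB c' j' ↔ c = c' ∧ j = j' := by
  rw [insertDiag, insertDiag,
    merge_inj _ (rest_subset hA hB) Finset.inter_subset_left disjoint_rest,
    (diagIdx_injective hA hAB).eq_iff]

lemma insertDiag_left (hA : A ∈ S) (hAB : d A = d B) (c : Idx d (rest S A B)) (j : Fin (d A)) :
    insertDiag hAB c j ⟨A, hA⟩ = j := by
  simp [insertDiag, merge, hA, diagIdx]

lemma insertDiag_right (hB : B ∈ S) (hAB : d A = d B) (c : Idx d (rest S A B)) (j : Fin (d A)) :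
    insertDiag hAB c j ⟨B, hB⟩ = Fin.cast hAB j := by
  simp [insertDiag, merge, hB, diagIdx]

lemma insertDiag_rest (hA : A ∈ S) (hB : B ∈ S) (hAB : d A = d B) (c : Idx d (rest S A B))
    (j : Fin (d A)) (i : {i // i ∈ S}) (h1 : i.1 ≠ A) (h2 : i.1 ≠ B) :
    insertDiag hAB c j i = c ⟨i.1, (mem_rest hA hB).mpr ⟨i.2, h1, h2⟩⟩ := by
  have : i.1 ∈ rest S A B := (mem_rest hA hB).mpr ⟨i.2, h1, h2⟩
  rw [insertDiag, merge, dif_pos this]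

lemma contract_apply (hA : A ∈ S) (hB : B ∈ S) (hAB : d A = d B) (M : Op d S)
    (c c' : Idx d (rest S A B)) :
    contract A B M c c' = ∑ j, ∑ j', M (insertDiag hAB c j) (insertDiag hAB c' j') := by
  have hA' : A ∈ S ∩ {A, B} := by simp [hA]
  have hB' : B ∈ S ∩ {A, B} := by simp [hB]
  have key : ∀ f : Idx d (S ∩ {A, B}) → ℂ,
      ∑ k, (if ((k ⟨A, hA'⟩ : Fin (d A)) : ℕ) = (k ⟨B, hB'⟩ : Fin (d B)) then f k else 0) =
        ∑ j, f (diagIdx S hAB j) := by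
    intro f
    have h1 : ∀ j, f (diagIdx S hAB j) = ∑ k, if k = diagIdx S hAB j then f k else 0 :=
      fun j => by simp
    simp only [h1]
    rw [Finset.sum_comm]
    refine Finset.sum_congr rfl fun k _ => ?_
    split_ifs with hk
    · have hkd : k = diagIdx S hAB (k ⟨A, hA'⟩) := by
        funext i
        obtain ⟨i, hi⟩ := i
        have hi2 := (Finset.mem_inter.mp hi).2
        rcases Finset.mem_insert.mp hi2 with rfl | h
        · rfl
        · obtain rfl := Finset.mem_singleton.mp h
          exact Fin.ext hk.symm
      rw [Finset.sum_eq_single (k ⟨A, hA'⟩)]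
      · rw [if_pos hkd]
      · intro j _ hj
        rw [if_neg]
        intro h
        exact hj (diagIdx_injective hA hAB (h.symm.trans hkd))
      · simp
    · symm
      refine Finset.sum_eq_zero fun j _ => if_neg ?_
      rintro rfl
      exact hk rfl
  have hΦ : ∀ k k' : Idx d (S ∩ {A, B}), ∀ h : ({A, B} : Finset ι) ⊆ rest S A B ∪ (S ∩ {A, B}),
      Phi A B (merge h c k) (merge h c' k') =
      if ((k ⟨A, hA'⟩ : Fin (d A)) : ℕ) = (k ⟨B, hB'⟩ : Fin (d B)) then
        if ((k' ⟨A, hA'⟩ : Fin (d A)) : ℕ) = (k' ⟨B, hB'⟩ : Fin (d B)) then 1 else 0 else 0 := by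
    intro k k' h
    have nA : A ∉ rest S A B := fun h => ((mem_rest hA hB).mp h).2.1 rfl
    have nB : B ∉ rest S A B := fun h => ((mem_rest hA hB).mp h).2.2 rfl
    simp only [Phi, merge, nA, nB, dif_neg, not_false_eq_true, ite_and]
  refine Eq.trans ?_ (key fun k => ∑ j', M (merge subset_rest_union c k) (insertDiag hAB c' j'))
  simp only [contract, link, hΦ]
  refine Finset.sum_congr rfl fun k _ => ?_
  have h1 : ∑ j', M (merge subset_rest_union c k) (insertDiag hAB c' j') = _ :=
    (key fun k' => M (merge subset_rest_union c k) (merge subset_rest_union c' k')).symm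
  rw [h1]
  split_ifs
  · exact Finset.sum_congr rfl fun k' _ => by split_ifs <;> simp
  · simp

variable (hA : A ∈ S) (hB : B ∈ S) (hAB : d A = d B)

/-- Contraction as a linear map. -/
noncomputable def contractLinear (hA : A ∈ S) (hB : B ∈ S) (hAB : d A = d B) :
    Op d S →ₗ[ℂ] Op d (rest S A B) where
  toFun := contract A B
  map_add' M N := by
    ext c c'
    simp only [Matrix.add_apply, contract_apply hA hB hAB, Finset.sum_add_distrib]
  map_smul' t M := by
    ext c c'
    simp only [Matrix.smul_apply, contract_apply hA hB hAB, Finset.smul_sum, RingHom.id_apply]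

lemma contractLinear_apply (M : Op d S) : contractLinear hA hB hAB M = contract A B M := rfl

lemma contractLinear_apply_apply (M : Op d S) (c c' : Idx d (rest S A B)) :
    contractLinear hA hB hAB M c c' =
      ∑ j, ∑ j', M (insertDiag hAB c j) (insertDiag hAB c' j') :=
  contract_apply hA hB hAB M c c'

lemma contractLinear_conjTranspose (M : Op d S) :
    contractLinear hA hB hAB Mᴴ = (contractLinear hA hB hAB M)ᴴ := by
  ext c c'
  simp only [contractLinear_apply_apply, Matrix.conjTranspose_apply, star_sum]
  exact Finset.sum_comm

lemma contractLinear_posSemidef {M : Op d S} (hM : M.PosSemidef) :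
    (contractLinear hA hB hAB M).PosSemidef := by
  have := posSemidef_sum_sum (hM.submatrix fun z : Fin (d A) × Idx d (rest S A B) =>
    insertDiag hAB z.2 z.1)
  convert this using 1
  ext c c'
  simp only [contractLinear_apply_apply, Matrix.of_apply, Matrix.submatrix_apply]

lemma contractLinear_one : contractLinear hA hB hAB (1 : Op d S) = (d A : ℂ) • 1 := by
  ext c c'
  simp only [contractLinear_apply_apply, Matrix.one_apply, insertDiag_inj hA hB, Matrix.smul_apply,
    ite_and]
  by_cases h : c = c' <;> simp [h]

/-- Contraction commutes with superoperators on the remaining systems. -/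
lemma contractLinear_loc {K : (i : ι) → Kernel (d i)} (h1 : K A = 1) (h2 : K B = 1)
    (M : Op d S) :
    contractLinear hA hB hAB (loc K M) = loc K (contractLinear hA hB hAB M) := by
  have hK : ∀ b b' v v' : Idx d (S ∩ {A, B}), ∏ i : {i // i ∈ S ∩ {A, B}},
      K i.1 (b i, b' i) (v i, v' i) = if b = v then if b' = v' then 1 else 0 else 0 := by
    intro b b' v v'
    rw [← ite_and, ← prod_one_kernel]
    refine Finset.prod_congr rfl fun i _ => ?_
    have : K i.1 = 1 := by
      obtain ⟨i, hi⟩ := i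
      have h := (Finset.mem_inter.mp hi).2
      rcases Finset.mem_insert.mp h with rfl | h
      · exact h1
      · obtain rfl := Finset.mem_singleton.mp h
        exact h2
    rw [this]
  ext c c'
  rw [contractLinear_apply_apply, loc_apply]
  simp only [contractLinear_apply_apply, Finset.mul_sum]
  rw [sum_comm_two_two]
  refine Finset.sum_congr rfl fun j _ => Finset.sum_congr rfl fun j' _ => ?_
  simp only [insertDiag]
  rw [loc_merge _ (rest_subset hA hB) Finset.inter_subset_left disjoint_rest]
  simp only [hK]
  refine Finset.sum_congr rfl fun u _ => ?_
  rw [Finset.sum_eq_single (diagIdx S hAB j) (fun v _ hv => by simp [hv.symm]) (by simp)]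
  refine Finset.sum_congr rfl fun u' _ => ?_
  rw [Finset.sum_eq_single (diagIdx S hAB j') (fun v _ hv => by simp [hv.symm]) (by simp)]
  simp

lemma contractLinear_depol {U : Finset ι} (h1 : A ∉ U) (h2 : B ∉ U) (M : Op d S) :
    contractLinear hA hB hAB (depol U M) = depol U (contractLinear hA hB hAB M) :=
  contractLinear_loc hA hB hAB (by simp [depolKernels, h1]) (by simp [depolKernels, h2]) M

end Contraction

/-! ### Moving superoperators under a contraction -/

section Swap

variable {ι : Type u} [DecidableEq ι] {d : ι → ℕ} {S : Finset ι} {A B : ι}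
  (hA : A ∈ S) (hB : B ∈ S) (hAB : d A = d B)

lemma contractLinear_site_apply (k : Kernel (d A)) (M : Op d S) (c c' : Idx d (rest S A B)) :
    contractLinear hA hB hAB (site A k M) c c' = ∑ j, ∑ j', ∑ l, ∑ l', k (j, j') (l, l') *
      M (Function.update (insertDiag hAB c j) ⟨A, hA⟩ l)
        (Function.update (insertDiag hAB c' j') ⟨A, hA⟩ l') := by
  simp only [contractLinear_apply_apply, site_apply hA, insertDiag_left]

lemma update_insertDiag (hne : A ≠ B) (c : Idx d (rest S A B)) (j l : Fin (d A)) :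
    Function.update (insertDiag hAB c j) ⟨A, hA⟩ l =
      Function.update (insertDiag hAB c l) ⟨B, hB⟩ (Fin.cast hAB j) := by
  funext i
  by_cases h1 : i = ⟨A, hA⟩
  · subst h1
    rw [Function.update_self, Function.update_of_ne (by simpa using hne), insertDiag_left]
  · by_cases h2 : i = ⟨B, hB⟩
    · subst h2
      rw [Function.update_self, Function.update_of_ne h1, insertDiag_right]
    · rw [Function.update_of_ne h1, Function.update_of_ne h2]
      have h1' : i.1 ≠ A := fun h => h1 (Subtype.ext h)
      have h2' : i.1 ≠ B := fun h => h2 (Subtype.ext h)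
      rw [insertDiag_rest hA hB hAB c j i h1' h2', insertDiag_rest hA hB hAB c l i h1' h2']

/-- Before a contraction, a superoperator on `A` can be moved to `B` by transposition; here for the
depolarizing map, which is its own transpose. -/
lemma contractLinear_depol_left (hne : A ≠ B) (M : Op d S) :
    contractLinear hA hB hAB (depol {A} M) = contractLinear hA hB hAB (depol {B} M) := by
  ext c c'
  rw [depol_singleton, depol_singleton, contractLinear_site_apply, contractLinear_apply_apply]
  simp only [site_apply hB, insertDiag_right, depolKernel_apply, ite_and, ite_mul, zero_mul,
    Fin.cast_inj, Finset.sum_ite_irrel, Finset.sum_const_zero, Finset.sum_ite_eq, Finset.mem_univ,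
    if_true]
  rw [Finset.sum_comm]
  refine Finset.sum_congr rfl fun l _ => ?_
  rw [← (finCongr hAB).sum_comp]
  refine Finset.sum_congr rfl fun j _ => ?_
  rw [update_insertDiag hA hB hAB hne, update_insertDiag hA hB hAB hne]
  have hinv : ((d A : ℕ) : ℂ)⁻¹ = (d B : ℂ)⁻¹ := by rw [hAB]
  rw [hinv]
  rfl

/-- A non-zero operator has a non-zero contraction after a suitable superoperator on `A`, namely
one that moves a given matrix element of `A` to a place where the contraction picks it up. -/
lemma exists_contractLinear_site_ne_zero {X : Op d S} (hX : X ≠ 0) :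
    ∃ k : Kernel (d A), contractLinear hA hB hAB (site A k X) ≠ 0 := by
  obtain ⟨m, m', hm⟩ : ∃ m m', X m m' ≠ 0 := by
    by_contra! h
    exact hX (Matrix.ext h)
  have hupd : ∀ m : Idx d S, Function.update (insertDiag hAB (restrict (rest_subset hA hB) m)
      (Fin.cast hAB.symm (m ⟨B, hB⟩))) ⟨A, hA⟩ (m ⟨A, hA⟩) = m := by
    intro m
    funext i
    by_cases h1 : i = ⟨A, hA⟩
    · subst h1; rw [Function.update_self]
    · rw [Function.update_of_ne h1]
      by_cases h2 : i = ⟨B, hB⟩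
      · subst h2; rw [insertDiag_right]; rfl
      · rw [insertDiag_rest hA hB hAB _ _ i (fun h => h1 (Subtype.ext h))
          (fun h => h2 (Subtype.ext h))]
        rfl
  refine ⟨Matrix.single (Fin.cast hAB.symm (m ⟨B, hB⟩), Fin.cast hAB.symm (m' ⟨B, hB⟩))
    (m ⟨A, hA⟩, m' ⟨A, hA⟩) 1, fun h => hm ?_⟩
  have := congrFun (congrFun h (restrict (rest_subset hA hB) m)) (restrict (rest_subset hA hB) m')
  rw [contractLinear_site_apply] at this
  simpa [Matrix.single_apply, ite_and, Finset.sum_ite_irrel, hupd] using this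

end Swap

/-! ### Contractions of no-signalling maps are channels -/

section Channel

variable {ι : Type u} [DecidableEq ι] {d : ι → ℕ} {S : Finset ι} {A B : ι}

/-- Channels from `I` to `O` are deterministic maps of type `(I → O)`. -/
lemma isDeterministic_channel {I O : Finset ι} (hS : S = I ∪ O) (hdisj : Disjoint I O)
    (hd : ∀ i ∈ S, 1 ≤ d i) {R : Op d S} (hR : R.PosSemidef)
    (hRO : depol O R = (dim d O)⁻¹ • (1 : Op d S)) :
    IsDeterministic (.arr (.ele I) (.ele O)) R := by
  subst hS
  have hdO : ∀ i ∈ O, 1 ≤ d i := fun i hi => hd i (Finset.mem_union_right _ hi)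
  refine (isDeterministic_iff (x := .arr (.ele I) (.ele O)) ⟨trivial, trivial, hdisj⟩ hd).mpr
    ⟨hR, ?_⟩
  have key : ∀ ρ : Op d I, ρ.trace = 1 → (choiApply R ρ).trace = 1 := by
    intro ρ hρ
    rw [← trace_depol hdO O]
    nth_rw 1 [← depol_eq_self hdisj ρ]
    rw [← choiApply_depol hdisj, hRO, map_smul, LinearMap.smul_apply, choiApply_one hdisj,
      trace_smul, trace_smul, trace_one_Idx, hρ, smul_eq_mul, smul_eq_mul, one_mul,
      inv_mul_cancel₀ (dim_ne_zero hdO)]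
  exact key

lemma isDeterministic_depol_outs {z : QType ι} (hz : z.WellLabelled) (hd : ∀ i ∈ S, 1 ≤ d i)
    {R : Op d S} (h : IsDeterministic z R) :
    z.outs ⊆ S ∧ depol z.outs R = (dim d z.outs)⁻¹ • (1 : Op d S) := by
  obtain rfl : S = z.systems := by
    obtain ⟨h1, -⟩ := h
    exact h1.1.antisymm h1.2
  exact ⟨z.outs_subset, depol_outs_eq_of_mem hz hd ((isDeterministic_iff hz hd).mp h).2⟩

lemma dim_outs_eq {x : QType ι} (hB : B ∈ x.outs) :
    dim d x.outs = dim d (x.outs.erase B) * d B := by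
  rw [dim_split (S := x.outs) (U := x.outs.erase B) (V := {B})
    (by intro i hi; by_cases h : i = B <;> simp [h, hi]) (Finset.erase_subset _ _)
    (by simpa using hB) (by simp)]
  congr 1
  rw [dim, Finset.prod_coe_sort {B} fun i => (d i : ℂ), Finset.prod_singleton]

theorem contractionAdmissible_of_typeNoSignalling {x : QType ι} (hx : x.WellLabelled)
    (hd : ∀ i ∈ x.systems, 1 ≤ d i) (hA : A ∈ x.ins) (hB : B ∈ x.outs) (hAB : d A = d B)
    (h : TypeNoSignalling d x A B) : ContractionAdmissible d x A B := by
  intro R hR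
  have hAs := x.ins_subset hA
  have hBs := x.outs_subset hB
  have hAo : A ∉ x.outs := (QType.mem_ins_iff.mp hA).2
  have hBi : B ∉ x.ins := (QType.mem_outs_iff.mp hB).2
  have hne : A ≠ B := fun h => hAo (h ▸ hB)
  have hns := (mapNoSignalling_iff hd hA hB R).mp (h R hR)
  obtain ⟨hR0, hR1⟩ := (isDeterministic_iff hx hd).mp hR
  set O := x.outs.erase B with hO
  have hAO : A ∉ O := fun h => hAo (Finset.mem_of_mem_erase h)
  have hBO : B ∉ O := Finset.notMem_erase _ _
  have hdisj : Disjoint (x.ins.erase A) O :=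
    x.disjoint_ins_outs.mono (Finset.erase_subset _ _) (Finset.erase_subset _ _)
  refine ⟨.arr (.ele (x.ins.erase A)) (.ele O), ⟨trivial, trivial, hdisj⟩, ?_⟩
  refine isDeterministic_channel (S := rest x.systems A B) ?_ hdisj
    (fun i hi => hd i (rest_subset hAs hBs hi)) (contractLinear_posSemidef hAs hBs hAB hR0) ?_
  · ext i
    rw [mem_rest hAs hBs, Finset.mem_union, hO, Finset.mem_erase, Finset.mem_erase,
      QType.mem_outs_iff]
    have : i ∈ x.ins → i ∈ x.systems := fun h => x.ins_subset h
    have : i = B → i ∉ x.ins := by rintro rfl; exact hBi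
    have : i = A → i ∈ x.ins := by rintro rfl; exact hA
    tauto
  · change depol O (contractLinear hAs hBs hAB R) = _
    have hBR : depol {B} (depol O R) = (dim d x.outs)⁻¹ • (1 : Op d x.systems) := by
      rw [depol_depol hd, ← depol_outs_eq_of_mem hx hd hR1]
      exact depol_congr (fun i _ => by rw [← Finset.insert_eq, hO, Finset.insert_erase hB]) R
    -- `A` may be depolarized twice by `hns`, and once of this is moved to `B`
    rw [← contractLinear_depol hAs hBs hAB hAO hBO, ← hns,
      show depol {A} (depol O R) = depol {A} (depol {A} (depol O R)) by rw [hns, hns],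
      contractLinear_depol_left hAs hBs hAB hne, depol_depol hd, Finset.union_comm,
      ← depol_depol hd, hBR, map_smul, depol_one hd, map_smul, contractLinear_one, smul_smul,
      dim_outs_eq hB, hAB]
    have : (d B : ℂ) ≠ 0 := by
      have := hd B hBs
      exact_mod_cast (by omega : d B ≠ 0)
    rw [mul_inv, inv_mul_cancel_right₀ this]

end Channel

/-! ### Biased states -/

section Signalling

variable {ι : Type u} [DecidableEq ι] {d : ι → ℕ} {S : Finset ι} {A B : ι}

/-- A state that is diagonal with positive entries and not maximally mixed. -/
noncomputable def biasVec (n : ℕ) (p : Fin n × Fin n) : ℂ :=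
  if p.1 = p.2 then (if (p.1 : ℕ) = 0 then 2 else 1) / (n + 1) else 0

/-- The map that discards its argument and prepares the biased state. -/
noncomputable def biasKernel (n : ℕ) : Kernel n := vecMulVec (biasVec n) (unitVec n)

lemma biasKernel_TP {n : ℕ} (hn : 1 ≤ n) : IsTP (biasKernel n) := by
  have h : unitVec n ⬝ᵥ biasVec n = 1 := by
    obtain ⟨k, rfl⟩ : ∃ k, n = k + 1 := ⟨n - 1, by omega⟩
    simp only [dotProduct, unitVec, biasVec, Fintype.sum_prod_type, ite_mul, one_mul, zero_mul,
      Finset.sum_ite_eq, Finset.mem_univ, if_true, ← Finset.sum_div]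
    rw [Fin.sum_univ_succ]
    simp
    have : (k : ℂ) + 1 + 1 ≠ 0 := by exact_mod_cast (by omega : k + 1 + 1 ≠ 0)
    field_simp
    ring
  rw [IsTP, biasKernel, vecMul_vecMulVec, h, one_smul]

lemma biasKernel_mulVec (n : ℕ) : biasKernel n *ᵥ unitVec n = (n : ℂ) • biasVec n := by
  rw [biasKernel, vecMulVec_mulVec, unitVec_dotProduct_self]
  ext p
  simp [mul_comm]

variable (d) in
/-- The kernels that prepare biased states on the systems in `O`. -/
noncomputable def biasKernels (O : Finset ι) (i : ι) : Kernel (d i) :=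
  if i ∈ O then biasKernel (d i) else 1

lemma biasKernels_TP (O : Finset ι) {i : ι} (hi : 1 ≤ d i) : IsTP (biasKernels d O i) := by
  unfold biasKernels; split_ifs
  exacts [biasKernel_TP hi, .one]

/-- The biased state on the systems in `O` (with normalization `dim d O`), tensored with the
identity. -/
noncomputable def bias (O : Finset ι) : Op d S := loc (biasKernels d O) 1

lemma bias_apply (O : Finset ι) (c c' : Idx d S) : (bias O : Op d S) c c' =
    ∏ i : {i // i ∈ S}, (biasKernels d O i.1 *ᵥ unitVec (d i.1)) (c i, c' i) :=
  loc_apply_one _ c c'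

lemma bias_eq_diagonal (hd : ∀ i ∈ S, 1 ≤ d i) (O : Finset ι) :
    ∃ f : Idx d S → ℝ, (∀ c, 0 < f c) ∧
      (bias O : Op d S) = diagonal fun c => (f c : ℂ) := by
  refine ⟨fun c => ∏ i : {i // i ∈ S},
    if i.1 ∈ O then (d i.1 : ℝ) * ((if (c i : ℕ) = 0 then 2 else 1) / (d i.1 + 1)) else 1,
    fun c => Finset.prod_pos fun i _ => ?_, ?_⟩
  · have : (0 : ℝ) < d i.1 := by exact_mod_cast hd i.1 i.2
    split_ifs <;> positivity
  · ext c c'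
    rw [bias_apply]
    by_cases h : c = c'
    · subst h
      rw [diagonal_apply_eq, Complex.ofReal_prod]
      refine Finset.prod_congr rfl fun i _ => ?_
      unfold biasKernels
      split_ifs with h1 h2
      · rw [biasKernel_mulVec]; simp [biasVec, h2]
      · rw [biasKernel_mulVec]; simp [biasVec, h2]
      · simp [unitVec]
    · rw [diagonal_apply_ne _ h]
      obtain ⟨i, hi⟩ := Function.ne_iff.mp h
      refine Finset.prod_eq_zero (Finset.mem_univ i) ?_
      unfold biasKernels
      split_ifs with h1
      · rw [biasKernel_mulVec]; simp [biasVec, hi]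
      · simp [unitVec, hi]

/-- Small Hermitian perturbations of a positive diagonal matrix are positive. -/
lemma exists_pos_perturbation_diagonal {n : Type*} [Fintype n] [DecidableEq n] {f : n → ℝ}
    (hf : ∀ i, 0 < f i) {H : Matrix n n ℂ} (hH : H.IsHermitian) :
    ∃ ε : ℝ, 0 < ε ∧ ∀ t : ℝ, |t| ≤ ε →
      (diagonal (fun i => (f i : ℂ)) + (t : ℂ) • H).PosSemidef := by
  -- `m` is a lower bound of `f`
  set m : ℝ := (1 + ∑ i, (f i)⁻¹)⁻¹ with hm
  have h0 : 0 ≤ ∑ i, (f i)⁻¹ := Finset.sum_nonneg fun i _ => (inv_pos.mpr (hf i)).le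
  have hm0 : 0 < m := by positivity
  have hmf : ∀ i, m ≤ f i := fun i => by
    have := Finset.single_le_sum (f := fun i => (f i)⁻¹)
      (fun i _ => (inv_pos.mpr (hf i)).le) (Finset.mem_univ i)
    exact inv_le_of_inv_le₀ (hf i) (by linarith)
  obtain ⟨ε, hε, h⟩ := exists_pos_perturbation hH hm0
  refine ⟨ε, hε, fun t ht => ?_⟩
  have h1 : (diagonal fun i => ((f i - m : ℝ) : ℂ)).PosSemidef :=
    PosSemidef.diagonal fun i => by
      simpa using (by exact_mod_cast sub_nonneg.mpr (hmf i) : (0 : ℂ) ≤ ((f i - m : ℝ) : ℂ))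
  convert h1.add (h t ht) using 1
  rw [← add_assoc]
  congr 1
  ext i j
  by_cases hij : i = j
  · subst hij; simp
  · simp [hij]

/-- Depolarizing systems that include all biased ones leaves the identity. -/
lemma depol_bias (hd : ∀ i ∈ S, 1 ≤ d i) {O U : Finset ι} (hOU : O ⊆ U) :
    depol U (bias O : Op d S) = 1 := by
  rw [bias, depol, loc_loc]
  refine loc_one_eq_one fun i hi => ?_
  by_cases h : i ∈ O
  · rw [depolKernels, if_pos (hOU h), depolKernel_mul (biasKernels_TP O (hd i hi))]
    exact .depolKernel (hd i hi)
  · rw [biasKernels, if_neg h, mul_one]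
    exact depolKernels_unital U (hd i hi)

lemma depol_bias_of_disjoint (hd : ∀ i ∈ S, 1 ≤ d i) {O U : Finset ι} (hOU : Disjoint U O) :
    depol U (bias O : Op d S) = bias O := by
  ext c c'
  rw [bias, depol, loc_loc, loc_apply_one, loc_apply_one]
  refine Finset.prod_congr rfl fun i _ => ?_
  by_cases h : i.1 ∈ O
  · rw [depolKernels, if_neg (Finset.disjoint_right.mp hOU h), one_mul]
  · rw [biasKernels, if_neg h, mul_one, depolKernels_unital U (hd i.1 i.2), one_mulVec]

/-- Depolarizing all systems except a biased one does not leave a multiple of the identity. -/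
lemma depol_bias_ne_smul_one (hd : ∀ i ∈ S, 2 ≤ d i) {O : Finset ι} {D : ι} (hDS : D ∈ S)
    (hDO : D ∈ O) (s : ℂ) : depol (S.erase D) (bias O : Op d S) ≠ s • (1 : Op d S) := by
  intro h
  have hd1 : ∀ i ∈ S, 1 ≤ d i := fun i hi => (by norm_num : 1 ≤ 2).trans (hd i hi)
  have key : ∀ c : Idx d S,
      (d D : ℂ) * ((if (c ⟨D, hDS⟩ : ℕ) = 0 then 2 else 1) / (d D + 1)) = s := by
    intro c
    have h1 := congrFun (congrFun h c) c
    rw [bias, depol, loc_loc, loc_apply_one,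
      Finset.prod_eq_single (⟨D, hDS⟩ : {i // i ∈ S})] at h1
    · rw [depolKernels, if_neg (Finset.notMem_erase _ _), one_mul, biasKernels, if_pos hDO,
        biasKernel_mulVec] at h1
      simpa [biasVec] using h1
    · intro i _ hi
      have : i.1 ∈ S.erase D := Finset.mem_erase.mpr ⟨fun h => hi (Subtype.ext h), i.2⟩
      rw [depolKernels, if_pos this, depolKernel_mul (biasKernels_TP O (hd1 i.1 i.2)),
        IsUnital.depolKernel (hd1 i.1 i.2), unitVec, if_pos rfl]
    · exact fun h => absurd (Finset.mem_univ _) h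
  have h0 := key fun i => ⟨0, hd1 i.1 i.2⟩
  have h1 := key fun i => ⟨1, hd i.1 i.2⟩
  rw [← h1] at h0
  have e1 : (d D : ℂ) ≠ 0 := by
    have := hd D hDS
    exact_mod_cast (by omega : d D ≠ 0)
  have e2 : (d D : ℂ) + 1 ≠ 0 := by exact_mod_cast (by omega : d D + 1 ≠ 0)
  have h2 := mul_left_cancel₀ e1 h0
  rw [div_left_inj' e2] at h2
  norm_num at h2

lemma norm_inv_dim_le_half {J : Finset ι} (hd : ∀ i ∈ J, 2 ≤ d i) (hJ : J.Nonempty) :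
    ‖(dim d J)⁻¹‖ ≤ 1 / 2 := by
  obtain ⟨i, hi⟩ := hJ
  have h1 : 2 ≤ ∏ i : {i // i ∈ J}, d i.1 := by
    rw [Finset.prod_coe_sort J d, ← Finset.mul_prod_erase _ _ hi]
    have : 1 ≤ ∏ i ∈ J.erase i, d i := Finset.prod_pos fun k hk =>
      (by norm_num : 0 < 2).trans_le (hd k (Finset.mem_of_mem_erase hk))
    nlinarith [hd i hi]
  rw [dim_eq_natCast, norm_inv, Complex.norm_natCast, one_div]
  exact inv_anti₀ (by norm_num) (by exact_mod_cast h1)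

/-- A small perturbation `t • Y` on the systems outside `O` of the biased state on `O` is not the
Choi operator of a channel with outputs `U`: the bias forces all systems of `O` to be outputs, the
trace then forces `U = O`, and tracing out `O` leaves the perturbation. -/
lemma eq_zero_of_depol_bias_add (hd : ∀ i ∈ S, 2 ≤ d i) {O U : Finset ι} (hOS : O ⊆ S)
    (hUS : U ⊆ S) {Y : Op d S} (hY : depol O Y = Y) {t : ℂ} (ht : t ≠ 0)
    (hsmall : ‖t * (Y.trace / dim d S * dim d O)‖ < 1 / 2)
    (h : depol U ((dim d O)⁻¹ • bias O + t • Y) = (dim d U)⁻¹ • (1 : Op d S)) : Y = 0 := by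
  have hd1 : ∀ i ∈ S, 1 ≤ d i := fun i hi => (by norm_num : 1 ≤ 2).trans (hd i hi)
  have hdim : ∀ {V : Finset ι}, V ⊆ S → dim d V ≠ 0 := fun hV =>
    dim_ne_zero fun i hi => hd1 i (hV hi)
  have hOU : O ⊆ U := by
    intro D hD
    by_contra hDU
    have h1 := congrArg (depol (S.erase D)) h
    have h2 : depol (S.erase D) Y = (Y.trace / dim d S) • (1 : Op d S) := by
      rw [← depol_all (Finset.Subset.refl S), ← hY, depol_depol hd1, depol_depol hd1]
      refine depol_congr (fun i hi => ?_) Y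
      by_cases h : i = D
      · subst h; simp [hD, hi]
      · simp [h, hi]
    rw [depol_depol hd1, map_smul, depol_one hd1] at h1
    rw [depol_congr (V := S.erase D) (fun i hi => ?_), map_add, map_smul, map_smul, h2] at h1
    · refine depol_bias_ne_smul_one hd (hOS hD) hD
        (dim d O * ((dim d U)⁻¹ - t * (Y.trace / dim d S))) ?_
      rw [← eq_sub_iff_add_eq, smul_smul, ← sub_smul] at h1
      rw [mul_smul, ← h1, smul_smul, mul_inv_cancel₀ (hdim hOS), one_smul]
    · by_cases h : i = D
      · subst h; simp [hDU]
      · simp [h, hi]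
  rw [map_add, map_smul, map_smul, depol_bias hd1 hOU] at h
  have htr := congrArg Matrix.trace h
  rw [trace_add, trace_smul, trace_smul, trace_smul, trace_depol hd1, trace_one_Idx] at htr
  have hdU : dim d U = dim d O * dim d (U \ O) :=
    dim_split (by rw [Finset.union_sdiff_of_subset hOU]) hOU Finset.sdiff_subset
      Finset.disjoint_sdiff
  have hJS : U \ O ⊆ S := Finset.sdiff_subset.trans hUS
  have hJ : U \ O = ∅ := by
    by_contra hne
    have h1 := norm_inv_dim_le_half (d := d) (fun i hi => hd i (hJS hi))
      (Finset.nonempty_iff_ne_empty.mpr hne)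
    have h2 : t * (Y.trace / dim d S * dim d O) = (dim d (U \ O))⁻¹ - 1 := by
      have e1 := hdim (Finset.Subset.refl S)
      have e2 := hdim hOS
      have e3 := hdim hJS
      rw [hdU] at htr
      simp only [smul_eq_mul] at htr
      field_simp at htr ⊢
      linear_combination htr
    rw [h2, norm_sub_rev] at hsmall
    have h3 := norm_sub_norm_le (1 : ℂ) (dim d (U \ O))⁻¹
    rw [norm_one] at h3
    linarith
  obtain rfl : U = O := Finset.Subset.antisymm (Finset.sdiff_eq_empty_iff_subset.mp hJ) hOU
  rw [hY, add_eq_left] at h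
  exact (smul_eq_zero.mp h).resolve_left ht

end Signalling

/-! ### Admissible contractions force no-signalling -/

section Converse

variable {ι : Type u} [DecidableEq ι] {d : ι → ℕ} {A B : ι}

/-- The map that fixes the identity, and on traceless operators is `k` followed by the projection
onto traceless operators, is unital and trace preserving. -/
lemma depolKernel_add_unital_TP {n : ℕ} (hn : 1 ≤ n) (k : Kernel n) :
    IsUnital (depolKernel n + (1 - depolKernel n) * k * (1 - depolKernel n)) ∧
    IsTP (depolKernel n + (1 - depolKernel n) * k * (1 - depolKernel n)) := by
  have h1 : (1 - depolKernel n) *ᵥ unitVec n = 0 := by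
    rw [sub_mulVec, one_mulVec, IsUnital.depolKernel hn, sub_self]
  have h2 : unitVec n ᵥ* (1 - depolKernel n) = 0 := by
    rw [vecMul_sub, vecMul_one, IsTP.depolKernel hn, sub_self]
  constructor
  · rw [IsUnital, add_mulVec, ← mulVec_mulVec, h1, mulVec_zero, add_zero, IsUnital.depolKernel hn]
  · rw [IsTP, vecMul_add, mul_assoc, ← vecMul_vecMul, h2, zero_vecMul, add_zero,
      IsTP.depolKernel hn]

lemma site_mem_affineDet {x : QType ι} (hx : x.WellLabelled) {k : Kernel (d A)}
    (hU : IsUnital k) (hT : IsTP k) {M : Op d x.systems} (hM : M ∈ affineDet d x) :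
    site A k M ∈ affineDet d x := by
  refine loc_mem_affineDet x hx (fun i _ => ?_) (fun i _ => ?_) hM
  · by_cases h : i = A
    · subst h; rwa [Function.update_self]
    · rw [Function.update_of_ne h]; exact .one
  · by_cases h : i = A
    · subst h; rwa [Function.update_self]
    · rw [Function.update_of_ne h]; exact .one

lemma smul_bias_mem_affineDet {x : QType ι} (hx : x.WellLabelled)
    (hd : ∀ i ∈ x.systems, 1 ≤ d i) {O : Finset ι} (hO : O ⊆ x.outs) :
    (dim d x.outs)⁻¹ • (bias O : Op d x.systems) ∈ affineDet d x := by
  have hne : dim d x.outs ≠ 0 := dim_ne_zero fun i hi => hd i (x.outs_subset hi)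
  have h := depol_ins_mem hx hd (W := (dim d x.outs)⁻¹ • (bias O : Op d x.systems)) (by
    rw [bias, trace_smul, trace_loc (fun i hi => biasKernels_TP O (hd i hi)), trace_one_Idx,
      dim_systems, smul_eq_mul]
    field_simp)
  rwa [map_smul, depol_bias_of_disjoint hd (x.disjoint_ins_outs.mono_right hO)] at h

/-- If `R` is signalling from `A` to `B`, there is a direction of the affine space of deterministic
maps whose contraction is non-zero and is the identity on the outputs other than `B`. -/
lemma exists_contractLinear_sub_ne_zero {x : QType ι} (hx : x.WellLabelled)
    (hd : ∀ i ∈ x.systems, 1 ≤ d i) (hA : A ∈ x.ins) (hB : B ∈ x.outs) (hAs : A ∈ x.systems)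
    (hBs : B ∈ x.systems) (hAB : d A = d B)
    {R : Op d x.systems} (hR : R ∈ affineDet d x) (hs : ¬ MapNoSignalling x A B R) :
    ∃ P₁ ∈ affineDet d x, ∃ P₂ ∈ affineDet d x, contractLinear hAs hBs hAB (P₁ - P₂) ≠ 0 ∧
      depol (x.outs.erase B) (P₁ - P₂) = P₁ - P₂ := by
  have hAo : A ∉ x.outs := (QType.mem_ins_iff.mp hA).2
  have hne : A ≠ B := fun h => hAo (h ▸ hB)
  rw [mapNoSignalling_iff hd hA hB] at hs
  set O := x.outs.erase B with hO
  have hAO : A ∉ O := fun h => hAo (Finset.mem_of_mem_erase h)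
  set Q := depol O R with hQ
  have hQmem : Q ∈ affineDet d x := depol_mem_affineDet x hx hd O hR
  have hOQ : depol O Q = Q := by rw [hQ, depol_depol hd, Finset.union_idempotent]
  have hBQ : depol {B} Q = (dim d x.outs)⁻¹ • (1 : Op d x.systems) := by
    rw [hQ, depol_depol hd, ← depol_outs_eq_of_mem hx hd hR]
    exact depol_congr (fun i _ => by rw [← Finset.insert_eq, hO, Finset.insert_erase hB]) R
  set D := depolKernel (d A) with hD
  set X := Q - depol {A} Q with hX
  have hX0 : X ≠ 0 := fun h => hs (sub_eq_zero.mp h).symm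
  have hBX : depol {B} X = 0 := by
    rw [hX, map_sub, depol_depol hd {B} {A}, Finset.union_comm, ← depol_depol hd, hBQ, map_smul,
      depol_one hd, sub_self]
  have hXsite : X = site A (1 - D) Q := by
    rw [site_sub hAs, site_one, hX, depol_singleton]
  obtain ⟨k, hk⟩ := exists_contractLinear_site_ne_zero hAs hBs hAB hX0
  obtain ⟨hkU, hkT⟩ := depolKernel_add_unital_TP (hd A hAs) k
  have hP : site A (D + (1 - D) * k * (1 - D)) Q - site A D Q = site A ((1 - D) * k) X := by
    rw [hXsite, site_site, site_add hAs, add_sub_cancel_left]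
  refine ⟨_, site_mem_affineDet hx hkU hkT hQmem, site A D Q,
    site_mem_affineDet hx (.depolKernel (hd A hAs)) (.depolKernel (hd A hAs)) hQmem, ?_, ?_⟩
  · have hAB' : A ∉ ({B} : Finset ι) := by simpa using hne
    rw [hP, ← site_site, site_sub hAs, site_one, map_sub, ← depol_singleton,
      contractLinear_depol_left hAs hBs hAB hne, ← site_depol hAB', hBX, map_zero, map_zero,
      sub_zero]
    exact hk
  · rw [map_sub, ← site_depol hAO, ← site_depol hAO, hOQ]

theorem typeNoSignalling_of_contractionAdmissible {x : QType ι} (hx : x.WellLabelled)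
    (hd : ∀ i ∈ x.systems, 2 ≤ d i) (hA : A ∈ x.ins) (hB : B ∈ x.outs) (hAB : d A = d B)
    (h : ContractionAdmissible d x A B) : TypeNoSignalling d x A B := by
  intro R hR
  by_contra hs
  have hd1 : ∀ i ∈ x.systems, 1 ≤ d i := fun i hi => (by norm_num : 1 ≤ 2).trans (hd i hi)
  have hAs := x.ins_subset hA
  have hBs := x.outs_subset hB
  have hAo : A ∉ x.outs := (QType.mem_ins_iff.mp hA).2
  obtain ⟨P₁, hP₁, P₂, hP₂, hne, hPO⟩ := exists_contractLinear_sub_ne_zero hx hd1 hA hB hAs hBs hAB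
    ((isDeterministic_iff hx hd1).mp hR).2 hs
  set O := x.outs.erase B with hO
  have hAO : A ∉ O := fun h => hAo (Finset.mem_of_mem_erase h)
  have hBO : B ∉ O := Finset.notMem_erase _ _
  set C := contractLinear hAs hBs hAB with hC
  set X := P₁ - P₂ with hX
  have hXO : depol O (C X) = C X := by
    rw [hC, ← contractLinear_depol hAs hBs hAB hAO hBO, hPO]
  -- the contraction of the Hermitian or of the anti-Hermitian part of `X` is not zero
  obtain ⟨u, hu⟩ : ∃ u : ℂ, C (u • X + star u • Xᴴ) ≠ 0 := by
    by_contra! hall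
    have h1 := hall 1
    have h2 := hall Complex.I
    have h3 : C X = (1 / 2 : ℂ) • C ((1 : ℂ) • X + star (1 : ℂ) • Xᴴ) -
        (Complex.I / 2) • C (Complex.I • X + star Complex.I • Xᴴ) := by
      rw [← map_smul, ← map_smul, ← map_sub]
      congr 1
      simp only [star_one, Complex.star_def, Complex.conj_I, smul_add, smul_smul]
      have e1 : Complex.I / 2 * Complex.I = -(1 / 2) := by
        linear_combination (1 / 2 : ℂ) * Complex.I_mul_I
      have e2 : Complex.I / 2 * -Complex.I = 1 / 2 := by
        linear_combination (-1 / 2 : ℂ) * Complex.I_mul_I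
      rw [e1, e2]
      module
    rw [h1, h2, smul_zero, smul_zero, sub_zero] at h3
    exact hne h3
  set H := u • X + star u • Xᴴ with hH
  have hHherm : H.IsHermitian := by
    rw [Matrix.IsHermitian, hH, conjTranspose_add, conjTranspose_smul, conjTranspose_smul,
      conjTranspose_conjTranspose, star_star, add_comm]
  have hHO : depol O (C H) = C H := by
    rw [hH, map_add, map_smul, map_smul, hC, contractLinear_conjTranspose, ← hC, map_add, map_smul,
      map_smul, depol_conjTranspose, hXO]
  have hdimO : dim d x.outs = dim d O * d B := dim_outs_eq hB
  have hdB : (d B : ℂ) ≠ 0 := by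
    have := hd B hBs
    exact_mod_cast (by omega : d B ≠ 0)
  obtain ⟨f, hf, hfb⟩ := bias_eq_diagonal hd1 O
  have hk0 : 0 < ((∏ i : {i // i ∈ x.outs}, d i.1 : ℕ) : ℝ)⁻¹ := inv_pos.mpr (by
    exact_mod_cast Finset.prod_pos fun (i : {i // i ∈ x.outs}) _ => hd1 i.1 (x.outs_subset i.2))
  have hR₀ : (dim d x.outs)⁻¹ • (bias O : Op d x.systems) =
      diagonal fun c => ((((∏ i : {i // i ∈ x.outs}, d i.1 : ℕ) : ℝ)⁻¹ * f c : ℝ) : ℂ) := by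
    rw [hfb, dim_eq_natCast, ← diagonal_smul]
    congr 1
    funext c
    simp
  obtain ⟨ε, hε, hpos⟩ := exists_pos_perturbation_diagonal (fun c => mul_pos hk0 (hf c)) hHherm
  rw [← hR₀] at hpos
  set w : ℂ := (C H).trace / dim d (rest x.systems A B) * dim d O with hw
  set t : ℝ := min ε (1 / (2 * (‖w‖ + 1))) with ht
  have ht0 : 0 < t := lt_min hε (by positivity)
  have hsmall : ‖(t : ℂ) * w‖ < 1 / 2 := by
    rw [norm_mul, Complex.norm_real, Real.norm_of_nonneg ht0.le]
    calc t * ‖w‖ < t * (‖w‖ + 1) := mul_lt_mul_of_pos_left (lt_add_one _) ht0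
      _ ≤ 1 / (2 * (‖w‖ + 1)) * (‖w‖ + 1) := by gcongr; exact min_le_right _ _
      _ = 1 / 2 := by field_simp
  have hmem : (dim d x.outs)⁻¹ • bias O + (t : ℂ) • H ∈ affineDet d x := by
    have h0 := smul_bias_mem_affineDet hx hd1 (O := O) (Finset.erase_subset _ _)
    have h1 := affineDet_add_smul_sub x h0 hP₁ hP₂ (t * u)
    have h2 := affineDet_add_smul_sub x h1 (affineDet_conjTranspose x hP₁)
      (affineDet_conjTranspose x hP₂) (t * star u)
    convert h2 using 1
    rw [hH, hX, conjTranspose_sub, smul_add, smul_smul, smul_smul, add_assoc]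
  obtain ⟨z, hz, hzdet⟩ := h _ ((isDeterministic_iff hx hd1).mpr
    ⟨hpos t (by rw [abs_of_pos ht0]; exact min_le_left _ _), hmem⟩)
  have hdr : ∀ i ∈ rest x.systems A B, 2 ≤ d i := fun i hi => hd i (rest_subset hAs hBs hi)
  obtain ⟨hzS, hzeq⟩ := isDeterministic_depol_outs (S := rest x.systems A B) hz
    (fun i hi => hd1 i (rest_subset hAs hBs hi)) hzdet
  have hCR : contract A B ((dim d x.outs)⁻¹ • bias O + (t : ℂ) • H) =
      (dim d O)⁻¹ • (bias O : Op d (rest x.systems A B)) + (t : ℂ) • C H := by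
    rw [← contractLinear_apply hAs hBs hAB, map_add, map_smul, map_smul, bias,
      contractLinear_loc hAs hBs hAB (by simp [biasKernels, hAO]) (by simp [biasKernels, hBO]),
      contractLinear_one, map_smul, smul_smul, hdimO, hAB, mul_inv, inv_mul_cancel_right₀ hdB]
    rfl
  rw [hCR] at hzeq
  refine hu (eq_zero_of_depol_bias_add hdr (fun i hi => ?_) hzS hHO
    (by exact_mod_cast ht0.ne') hsmall hzeq)
  rw [mem_rest hAs hBs]
  exact ⟨x.outs_subset (Finset.mem_of_mem_erase hi), fun h => hAO (h ▸ hi), fun h => hBO (h ▸ hi)⟩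

end Converse

end HOQ

theorem mainTheorem1 {ι : Type*} [DecidableEq ι] (d : ι → ℕ) (x : HOQ.QType ι)
    (hx : x.WellLabelled) (hd : ∀ i ∈ x.systems, 2 ≤ d i) (A B : ι)
    (hA : A ∈ x.ins) (hB : B ∈ x.outs) (hAB : d A = d B) :
    HOQ.ContractionAdmissible d x A B ↔ HOQ.TypeNoSignalling d x A B :=
  ⟨HOQ.typeNoSignalling_of_contractionAdmissible hx hd hA hB hAB,
    HOQ.contractionAdmissible_of_typeNoSignalling hx
      (fun i hi => (by norm_num : 1 ≤ 2).trans (hd i hi)) hA hB hAB⟩
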